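/- A GF(2)-grammar over an alphabet $\Sigma$ is a context-free grammar $G=(\Sigma,N,R,S)$ such that every string $w\in\Sigma^*$ has only finitely many parse trees; the language described by $G$ is the set of all strings $w\in\Sigma^*$ that have an odd number of parse trees (with root $S$). Let $k\ge 0$ and let $a_1,\dots,a_k$ be pairwise distinct letters of $\Sigma$. For a language $K\subseteq a_1^*a_2^*\cdots a_k^*$ let $$\mathrm{Dual}(K)=\sum_{\substack{(n_1,\dots,n_k)\in\mathbb{N}_0^k\\ a_1^{n_1}\cdots a_k^{n_k}\in K}} a_1^{n_1}\cdots a_k^{n_k}\in\mathbb{F}_2[[a_1,\dots,a_k]],$$ where on the right-hand side $a_1,\dots,a_k$ are commuting variables. Let $\mathbb{F}_2((a_1,\dots,a_k))$ denote the field of fractions of $\mathbb{F}_2[[a_1,\dots,a_k]]$ (its elements are called Laurent series). For $1\le j\le k$ let $\mathcal{A}_j\subseteq\mathbb{F}_2[[a_j]]$ be the set of all power series $f$ in the single variable $a_j$ that are algebraic, that is, $P(f)=0$ for some non-zero polynomial $P$ with coefficients in $\mathbb{F}_2[a_j]$. Let $R_{a_1,\dots,a_k}\subseteq\mathbb{F}_2((a_1,\dots,a_k))$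 be the set of all Laurent series that can be represented as $$\frac{\sum_{i=1}^{n}A_{i,1}A_{i,2}\cdots A_{i,k}}{\prod_{1\le i<j\le k}p_{i,j}}$$ for some $n\ge 0$, some $A_{i,j}\in\mathcal{A}_j$ ($1\le i\le n$, $1\le j\le k$) and some non-zero polynomials $p_{i,j}\in\mathbb{F}_2[a_i,a_j]$ ($1\le i<j\le k$). Theorem. If a language $K\subseteq a_1^*a_2^*\cdots a_k^*$ is described by a GF(2)-grammar over $\Sigma$, then $\mathrm{Dual}(K)\in R_{a_1,\dots,a_k}$. -/

import Mathlib

universe u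

/-- Finite sequences of parse trees of a context-free grammar `g` whose roots are labelled, from
left to right, by the given string of symbols.  A tree with root a terminal `t` is a single leaf;
a tree with root a nonterminal `A` consists of a rule `A → β` of `g` and of a sequence of parse
trees with roots labelled by the symbols of `β` (the subtrees of the root, in order). -/
inductive ParseForest {T : Type u} (g : ContextFreeGrammar.{u} T) :
    List (Symbol T g.NT) → Type u
  | nil : ParseForest g []
  | consTerminal (t : T) {α : List (Symbol T g.NT)} (rest : ParseForest g α) :
      ParseForest g (Symbol.terminal t :: α)
  | consNonterminal (A : g.NT) (β : List (Symbol T g.NT))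
      (hr : (⟨A, β⟩ : ContextFreeRule T g.NT) ∈ g.rules)
      (children : ParseForest g β) {α : List (Symbol T g.NT)} (rest : ParseForest g α) :
      ParseForest g (Symbol.nonterminal A :: α)

/-- The string of terminals at the leaves, read from left to right. -/
def ParseForest.yield {T : Type u} {g : ContextFreeGrammar.{u} T} :
    {α : List (Symbol T g.NT)} → ParseForest g α → List T
  | _, .nil => []
  | _, .consTerminal t rest => t :: rest.yield
  | _, .consNonterminal _ _ _ children rest => children.yield ++ rest.yield

/-- The set of parse trees of the string `w` as the nonterminal `A`. -/
def parseTrees {T : Type u} (g : ContextFreeGrammar.{u} T) (A : g.NT) (w : List T) :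
    Set (ParseForest g [Symbol.nonterminal A]) :=
  {t | t.yield = w}

/-- A GF(2)-grammar over the alphabet `T`.  Syntactically it is an ordinary context-free grammar;
it is required that every string has only finitely many parse trees (from the initial symbol). -/
structure GF2Grammar (T : Type u) extends ContextFreeGrammar.{u} T where
  finite_parseTrees : ∀ w : List T, (parseTrees toContextFreeGrammar initial w).Finite

/-- The set of all strings with an odd number of parse trees as `A`. -/
def GF2Grammar.languageFrom {T : Type u} (G : GF2Grammar T) (A : G.NT) : Language T :=
  {w | Odd (parseTrees G.toContextFreeGrammar A w).ncard}

/-- The language described by a GF(2)-grammar. -/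
def GF2Grammar.language {T : Type u} (G : GF2Grammar T) : Language T :=
  G.languageFrom G.initial

/-- The language `a₁* a₂* ⋯ a_k*`, for letters `a : Fin k → T`. -/
def starProduct {T : Type u} {k : ℕ} (a : Fin k → T) : Language T :=
  (List.ofFn fun i => KStar.kstar ({[a i]} : Language T)).prod

/-- The word `a₁^{n₁} a₂^{n₂} ⋯ a_k^{n_k}`. -/
def powerWord {T : Type u} {k : ℕ} (a : Fin k → T) (n : Fin k →₀ ℕ) : List T :=
  (List.ofFn fun i => List.replicate (n i) (a i)).flatten

open Classical in
/-- The power series over the two-element field, in variables indexed by `Fin k`, which is the sum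
of the monomials `a₁^{n₁} ⋯ a_k^{n_k}` over all exponents for which the word
`a₁^{n₁} ⋯ a_k^{n_k}` is in `K`. -/
noncomputable def dualSeries {T : Type u} {k : ℕ} (a : Fin k → T) (K : Language T) :
    MvPowerSeries (Fin k) (ZMod 2) :=
  fun n => if powerWord a n ∈ K then 1 else 0

/-- Laurent series in `k` variables over the two-element field: fractions of power series. -/
abbrev LaurentSeries2 (k : ℕ) : Type :=
  FractionRing (MvPowerSeries (Fin k) (ZMod 2))

/-- The set `R_{a₁, …, a_k}` of the Laurent series
`(∑ᵢ A_{i,1} ⋯ A_{i,k}) / ∏_{i < j} p_{i,j}`, where `A_{i,j}` is a power series in the single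
variable `a_j` that is algebraic over the polynomials in `a_j`, and `p_{i,j}` is a nonzero
polynomial in which no variables other than `a_i` and `a_j` occur. -/
def seriesR (k : ℕ) : Set (LaurentSeries2 k) :=
  {F | ∃ (n : ℕ) (A : Fin n → Fin k → PowerSeries (ZMod 2))
      (p : Fin k → Fin k → MvPolynomial (Fin k) (ZMod 2)),
      (∀ i j, IsAlgebraic (Polynomial (ZMod 2)) (A i j)) ∧
      (∀ i j, i < j → p i j ≠ 0 ∧ p i j ∈ MvPolynomial.supported (ZMod 2) {i, j}) ∧
      F = algebraMap (MvPowerSeries (Fin k) (ZMod 2)) (LaurentSeries2 k)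
            (∑ i, ∏ j, (A i j).toMvPowerSeries j) /
          algebraMap (MvPowerSeries (Fin k) (ZMod 2)) (LaurentSeries2 k)
            (∏ i, ∏ j ∈ Finset.Ioi i, (p i j : MvPowerSeries (Fin k) (ZMod 2)))}

/-! Let an automaton with states `Fin k` read words in the letter indices; its state is the last
letter read, and it refuses to descend. To each grammar symbol attach the `k × k` matrix whose `(i,
j)` entry sums, modulo 2, the commutative images of the yields of its trees over words leading from
state `i` to state `j`. These matrices are upper triangular. Concatenation of words becomes matrix
multiplication (`wordSeries_mul`), so the grammar becomes a polynomial system: the matrix of a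
nonterminal is the sum over its rules of the products of the matrices of the symbols on the right. A
nondecreasing word is determined by its content, so the dual series is the sum of the first row of
the matrix of the initial symbol (`sum_coeff_wordSeries`).

A loop at state `i` reads only the letter `i`, so diagonal entries are series in one variable. They
solve a polynomial system, and are algebraic if its Jacobian determinant does not vanish at the
solution: differentiating the system kills all Kähler differentials of the field they generate,
which is then a separable algebraic extension (`isAlgebraic_of_det_ne_zero`).

Off the diagonal, induct on `j - i`. Once all shorter entries are known, the `(i, j)` entries solve
a linear system whose coefficients are built from the diagonal entries at `i` and `j`. Its
determinant is algebraic over polynomials in `a_i, a_j`, so its inverse has a polynomial in these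
two variables as denominator (`inv_mem_seriesSubring`), and Cramer's rule applies
(`apply_mem_of_system`).

Both determinants are nonzero because their constant term is: it is the determinant of `1 - N` over
the two-element field, where a nonzero entry of `N` gives a derivation of one nonterminal from
another with all siblings erased. A cycle of such derivations would give some string infinitely many
trees (`det_one_sub_erasedParity_ne_zero`). -/

section

open Classical

/-! ### Decomposing and counting parse forests -/

namespace ParseForest

variable {T : Type u} {g : ContextFreeGrammar.{u} T}

/-- The number of nonterminal nodes. -/
def size : {α : List (Symbol T g.NT)} → ParseForest g α → ℕ
  | _, .nil => 0
  | _, .consTerminal _ rest => rest.size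
  | _, .consNonterminal _ _ _ children rest => 1 + children.size + rest.size

/-- A nonempty forest consists of its first tree and the forest of the other trees. -/
def cons : {X : Symbol T g.NT} → {α : List (Symbol T g.NT)} →
    ParseForest g [X] → ParseForest g α → ParseForest g (X :: α)
  | _, _, .consTerminal t _, f => .consTerminal t f
  | _, _, .consNonterminal A β hr c _, f => .consNonterminal A β hr c f

/-- The first tree of a forest. -/
def head {X : Symbol T g.NT} {α : List (Symbol T g.NT)} :
    ParseForest g (X :: α) → ParseForest g [X]
  | .consTerminal t _ => .consTerminal t .nil
  | .consNonterminal A β hr c _ => .consNonterminal A β hr c .nil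

/-- The forest of all trees but the first. -/
def tail {X : Symbol T g.NT} {α : List (Symbol T g.NT)} :
    ParseForest g (X :: α) → ParseForest g α
  | .consTerminal _ f => f
  | .consNonterminal _ _ _ _ f => f

theorem eq_nil (f : ParseForest g []) : f = .nil := by
  cases f; rfl

theorem head_cons {X : Symbol T g.NT} {α : List (Symbol T g.NT)}
    (t : ParseForest g [X]) (f : ParseForest g α) : (cons t f).head = t := by
  cases t with
  | consTerminal t r => rw [eq_nil r]; rfl
  | consNonterminal A β hr c r => rw [eq_nil r]; rfl

theorem tail_cons {X : Symbol T g.NT} {α : List (Symbol T g.NT)}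
    (t : ParseForest g [X]) (f : ParseForest g α) : (cons t f).tail = f := by
  cases t <;> rfl

theorem cons_head_tail {X : Symbol T g.NT} {α : List (Symbol T g.NT)}
    (f : ParseForest g (X :: α)) : cons f.head f.tail = f := by
  cases f <;> rfl

theorem yield_cons {X : Symbol T g.NT} {α : List (Symbol T g.NT)}
    (t : ParseForest g [X]) (f : ParseForest g α) :
    (cons t f).yield = t.yield ++ f.yield := by
  cases t with
  | consTerminal t r => rw [eq_nil r]; simp [cons, yield]
  | consNonterminal A β hr c r => rw [eq_nil r]; simp [cons, yield]

theorem size_cons {X : Symbol T g.NT} {α : List (Symbol T g.NT)}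
    (t : ParseForest g [X]) (f : ParseForest g α) :
    (cons t f).size = t.size + f.size := by
  cases t with
  | consTerminal t r => rw [eq_nil r]; simp [cons, size]
  | consNonterminal A β hr c r => rw [eq_nil r]; simp [cons, size]

theorem cons_injective {X : Symbol T g.NT} {α : List (Symbol T g.NT)}
    {t t' : ParseForest g [X]} {f f' : ParseForest g α} (h : cons t f = cons t' f') :
    t = t' ∧ f = f' :=
  ⟨by rw [← head_cons t f, h, head_cons], by rw [← tail_cons t f, h, tail_cons]⟩

/-- The tree with a given rule at the root. -/
def node {A : g.NT} {β : List (Symbol T g.NT)} (hr : (⟨A, β⟩ : ContextFreeRule T g.NT) ∈ g.rules)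
    (f : ParseForest g β) : ParseForest g [Symbol.nonterminal A] :=
  .consNonterminal A β hr f .nil

theorem yield_node {A : g.NT} {β : List (Symbol T g.NT)}
    (hr : (⟨A, β⟩ : ContextFreeRule T g.NT) ∈ g.rules) (f : ParseForest g β) :
    (node hr f).yield = f.yield := by
  simp [node, yield]

theorem size_node {A : g.NT} {β : List (Symbol T g.NT)}
    (hr : (⟨A, β⟩ : ContextFreeRule T g.NT) ∈ g.rules) (f : ParseForest g β) :
    (node hr f).size = 1 + f.size := by
  simp [node, size]

theorem node_injective {A : g.NT} {β : List (Symbol T g.NT)}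
    (hr : (⟨A, β⟩ : ContextFreeRule T g.NT) ∈ g.rules) :
    Function.Injective (node hr) := by
  intro f f' h
  simpa [node] using h

theorem exists_eq_node {A : g.NT} (t : ParseForest g [Symbol.nonterminal A]) :
    ∃ β hr, ∃ f : ParseForest g β, t = node (A := A) hr f := by
  cases t with
  | consNonterminal A β hr c r => exact ⟨β, hr, c, by rw [eq_nil r]; rfl⟩

/-- The number of forests with given roots and given yield. -/
noncomputable def count (g : ContextFreeGrammar.{u} T) (α : List (Symbol T g.NT)) (w : List T) :
    ℕ :=
  Nat.card {f : ParseForest g α // f.yield = w}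

/-- Every string has only finitely many forests with the given roots. -/
def FinitelyMany (g : ContextFreeGrammar.{u} T) (α : List (Symbol T g.NT)) : Prop :=
  ∀ w, Finite {f : ParseForest g α // f.yield = w}

theorem count_nil (w : List T) : count g [] w = if w = [] then 1 else 0 := by
  rw [count]
  split_ifs with h
  · subst h
    rw [Nat.card_eq_one_iff_unique]
    exact ⟨⟨fun a b => Subtype.ext (by rw [eq_nil a.1, eq_nil b.1])⟩, ⟨⟨.nil, rfl⟩⟩⟩
  · have : IsEmpty {f : ParseForest g [] // f.yield = w} :=
      ⟨fun f => h (by rw [← f.2, eq_nil f.1]; rfl)⟩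
    exact Nat.card_of_isEmpty

theorem eq_terminal {t : T} (f : ParseForest g [Symbol.terminal t]) :
    f = .consTerminal t .nil := by
  cases f with
  | consTerminal t r => rw [eq_nil r]

theorem count_terminal (t : T) (w : List T) :
    count g [Symbol.terminal t] w = if w = [t] then 1 else 0 := by
  rw [count]
  split_ifs with h
  · subst h
    rw [Nat.card_eq_one_iff_unique]
    exact ⟨⟨fun a b => Subtype.ext (by rw [eq_terminal a.1, eq_terminal b.1])⟩,
      ⟨⟨.consTerminal t .nil, rfl⟩⟩⟩
  · have : IsEmpty {f : ParseForest g [Symbol.terminal t] // f.yield = w} :=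
      ⟨fun f => h (by rw [← f.2, eq_terminal f.1]; rfl)⟩
    exact Nat.card_of_isEmpty

theorem finitelyMany_nil : FinitelyMany g [] := fun w =>
  Finite.of_injective (fun _ => ()) fun a b _ => Subtype.ext (by rw [eq_nil a.1, eq_nil b.1])

theorem finitelyMany_terminal (t : T) : FinitelyMany g [Symbol.terminal t] := fun w =>
  Finite.of_injective (fun _ => ()) fun a b _ =>
    Subtype.ext (by rw [eq_terminal a.1, eq_terminal b.1])

/-- Forests split according to the length of the yield of the first tree. -/
noncomputable def consEquiv (X : Symbol T g.NT) (α : List (Symbol T g.NT)) (w : List T) :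
    (Σ i : Fin (w.length + 1), {t : ParseForest g [X] // t.yield = w.take i} ×
        {f : ParseForest g α // f.yield = w.drop i}) ≃
      {f : ParseForest g (X :: α) // f.yield = w} :=
  Equiv.ofBijective
    (fun x => ⟨cons x.2.1.1 x.2.2.1, by
      rw [yield_cons, x.2.1.2, x.2.2.2, List.take_append_drop]⟩) <| by
    constructor
    · rintro ⟨i, ⟨t, ht⟩, ⟨f, hf⟩⟩ ⟨i', ⟨t', ht'⟩, ⟨f', hf'⟩⟩ h
      obtain ⟨rfl, rfl⟩ := cons_injective (Subtype.mk.inj h)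
      -- Cut points are bounded by the length of `w`, so the length of the first yield determines
      -- the cut.
      have hi : i = i' := by
        have h1 := congrArg List.length (ht.symm.trans ht')
        simp only [List.length_take] at h1
        ext
        omega
      subst hi
      rfl
    · rintro ⟨f, rfl⟩
      have h : f.yield = f.head.yield ++ f.tail.yield := by rw [← yield_cons, cons_head_tail]
      refine ⟨⟨⟨f.head.yield.length, ?_⟩, ⟨f.head, ?_⟩, ⟨f.tail, ?_⟩⟩, ?_⟩
      · rw [h, List.length_append]; omega
      · simp [h]
      · simp [h]
      · exact Subtype.ext (cons_head_tail f)

/-- Counts convolve over the cut points of the word. Finiteness is essential: `Nat.card` of an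
infinite type is 0, and the product rule for the counts could fail. -/
theorem count_cons {X : Symbol T g.NT} {α : List (Symbol T g.NT)}
    (hX : FinitelyMany g [X]) (hα : FinitelyMany g α) (w : List T) :
    count g (X :: α) w =
      ∑ i ∈ Finset.range (w.length + 1), count g [X] (w.take i) * count g α (w.drop i) := by
  have := hX
  have (i : Fin (w.length + 1)) := hX (w.take i)
  have (i : Fin (w.length + 1)) := hα (w.drop i)
  rw [count, Nat.card_congr (consEquiv X α w).symm, Nat.card_sigma, Finset.sum_range]
  simp only [Nat.card_prod, count]

theorem finitelyMany_cons {X : Symbol T g.NT} {α : List (Symbol T g.NT)}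
    (hX : FinitelyMany g [X]) (hα : FinitelyMany g α) : FinitelyMany g (X :: α) := fun w =>
  have (i : Fin (w.length + 1)) := hX (w.take i)
  have (i : Fin (w.length + 1)) := hα (w.drop i)
  Finite.of_equiv _ (consEquiv X α w)


theorem finitelyMany_of_forall {α : List (Symbol T g.NT)}
    (h : ∀ X ∈ α, FinitelyMany g [X]) : FinitelyMany g α := by
  induction α with
  | nil => exact finitelyMany_nil
  | cons X α ih =>
    exact finitelyMany_cons (h X List.mem_cons_self) (ih fun Y hY => h Y (List.mem_cons_of_mem _ hY))

theorem mem_rules_of_mem_filter {A : g.NT} {r : ContextFreeRule T g.NT}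
    (h : r ∈ g.rules.filter (·.input = A)) : (⟨A, r.output⟩ : ContextFreeRule T g.NT) ∈ g.rules := by
  obtain ⟨hr, rfl⟩ := Finset.mem_filter.1 h
  exact hr

/-- Trees correspond to rules and forests of subtrees. -/
noncomputable def nodeEquiv (A : g.NT) (w : List T) :
    (Σ r : {r // r ∈ g.rules.filter (·.input = A)},
        {f : ParseForest g r.1.output // f.yield = w}) ≃
      {t : ParseForest g [Symbol.nonterminal A] // t.yield = w} :=
  Equiv.ofBijective
    (fun x => ⟨node (A := A) (β := x.1.1.output) (mem_rules_of_mem_filter x.1.2) x.2.1, by rw [yield_node, x.2.2]⟩) <| by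
    constructor
    · rintro ⟨⟨⟨B, β⟩, hr⟩, ⟨f, hf⟩⟩ ⟨⟨⟨B', β'⟩, hr'⟩, ⟨f', hf'⟩⟩ h
      obtain ⟨-, rfl⟩ := Finset.mem_filter.1 hr
      obtain ⟨-, h1⟩ := Finset.mem_filter.1 hr'
      simp only at h1
      subst h1
      have h := Subtype.mk.inj h
      simp only [node, consNonterminal.injEq, and_true] at h
      obtain ⟨rfl, h⟩ := h
      cases h
      rfl
    · rintro ⟨t, rfl⟩
      obtain ⟨β, hr, f, rfl⟩ := exists_eq_node t
      exact ⟨⟨⟨⟨A, β⟩, Finset.mem_filter.2 ⟨hr, rfl⟩⟩, ⟨f, (yield_node hr f).symm⟩⟩, rfl⟩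

/-- The right-hand sides of the rules for `A` that derive some string of terminals. -/
noncomputable def productiveRules (g : ContextFreeGrammar.{u} T) (A : g.NT) :
    Finset (List (Symbol T g.NT)) :=
  {β ∈ (g.rules.filter (·.input = A)).image (·.output) | Nonempty (ParseForest g β)}

theorem mem_productiveRules {A : g.NT} {β : List (Symbol T g.NT)} :
    β ∈ productiveRules g A ↔
      (⟨A, β⟩ : ContextFreeRule T g.NT) ∈ g.rules ∧ Nonempty (ParseForest g β) := by
  simp only [productiveRules, Finset.mem_filter, Finset.mem_image]
  constructor
  · rintro ⟨⟨⟨A, β⟩, ⟨hr, rfl⟩, rfl⟩, h⟩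
    exact ⟨hr, h⟩
  · rintro ⟨hr, h⟩
    exact ⟨⟨⟨A, β⟩, ⟨hr, rfl⟩, rfl⟩, h⟩

/-! ### Good nonterminals and the absence of erasing cycles -/

/-- The nonterminals with at least one parse tree, and with finitely many for every string. -/
def Good (g : ContextFreeGrammar.{u} T) (A : g.NT) : Prop :=
  Nonempty (ParseForest g [Symbol.nonterminal A]) ∧ FinitelyMany g [Symbol.nonterminal A]

theorem finitelyMany_of_mem_productiveRules {A : g.NT} (hA : Good g A)
    {β : List (Symbol T g.NT)} (hβ : β ∈ productiveRules g A) : FinitelyMany g β := fun w =>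
  have := hA.2 w
  have hr := (mem_productiveRules.1 hβ).1
  Finite.of_injective
    (fun f : {f : ParseForest g β // f.yield = w} =>
      (⟨node hr f.1, by rw [yield_node, f.2]⟩ :
        {t : ParseForest g [Symbol.nonterminal A] // t.yield = w}))
    fun _ _ h => Subtype.ext (node_injective hr (Subtype.mk.inj h))

/-- Unproductive rules contribute 0. Leaving them out matters because every nonterminal in the
remaining right-hand sides is again good. -/
theorem count_nonterminal {A : g.NT} (hA : Good g A) (w : List T) :
    count g [Symbol.nonterminal A] w = ∑ β ∈ productiveRules g A, count g β w := by
  have := hA.2 w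
  have hfin : Finite (Σ r : {r // r ∈ g.rules.filter (·.input = A)},
      {f : ParseForest g r.1.output // f.yield = w}) := Finite.of_equiv _ (nodeEquiv A w).symm
  have (r : {r // r ∈ g.rules.filter (·.input = A)}) :
      Finite {f : ParseForest g r.1.output // f.yield = w} :=
    Finite.of_injective (fun f => (⟨r, f⟩ : Σ r : {r // r ∈ g.rules.filter (·.input = A)},
      {f : ParseForest g r.1.output // f.yield = w})) fun _ _ h => by simpa using h
  rw [count, Nat.card_congr (nodeEquiv A w).symm, Nat.card_sigma, productiveRules,
    Finset.sum_filter_of_ne, Finset.sum_image,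
    Finset.sum_coe_sort (g.rules.filter (·.input = A))
      (fun r => Nat.card {f : ParseForest g r.output // f.yield = w})]
  · rfl
  · rintro ⟨B, β⟩ h ⟨B', β'⟩ h' rfl
    simp only [Finset.coe_filter, Set.mem_ofPred_eq] at h h'
    rw [h.2, h'.2]
  · intro β _ h
    by_contra hne
    refine h ?_
    have : IsEmpty {f : ParseForest g β // f.yield = w} := ⟨fun f => hne ⟨f.1⟩⟩
    exact Nat.card_of_isEmpty

/-- A tree for one of the symbols of a string with a forest can be completed to a forest. -/
theorem exists_context {α : List (Symbol T g.NT)} (h : Nonempty (ParseForest g α))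
    {X : Symbol T g.NT} (hX : X ∈ α) :
    ∃ φ : ParseForest g [X] → ParseForest g α, Function.Injective φ ∧
      ∃ u v, ∀ t, (φ t).yield = u ++ t.yield ++ v := by
  obtain ⟨f⟩ := h
  induction α with
  | nil => simp at hX
  | cons Y α ih =>
    rcases List.mem_cons.1 hX with rfl | hX
    · exact ⟨fun t => cons t f.tail, fun _ _ h => (cons_injective h).1, [], f.tail.yield,
        fun t => by simp [yield_cons]⟩
    · obtain ⟨φ, hφ, u, v, huv⟩ := ih hX f.tail
      exact ⟨fun t => cons f.head (φ t), fun _ _ h => hφ (cons_injective h).2,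
        f.head.yield ++ u, v, fun t => by simp [yield_cons, huv]⟩

/-- Plugging trees for `B` into a fixed forest for `β` is injective and only adds a fixed prefix and
suffix to the yield, so infinitely many trees for `B` would give infinitely many forests for `β`. -/
theorem Good.of_mem_productiveRules {A : g.NT} (hA : Good g A) {β : List (Symbol T g.NT)}
    (hβ : β ∈ productiveRules g A) {B : g.NT} (hB : Symbol.nonterminal B ∈ β) : Good g B := by
  obtain ⟨f⟩ := (mem_productiveRules.1 hβ).2
  obtain ⟨φ, hφ, u, v, huv⟩ := exists_context ⟨f⟩ hB
  constructor
  · clear huv hφ φ hβ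
    induction β with
    | nil => simp at hB
    | cons Y α ih =>
      rcases List.mem_cons.1 hB with rfl | hB
      · exact ⟨f.head⟩
      · exact ih hB f.tail
  · intro w
    have := finitelyMany_of_mem_productiveRules hA hβ (u ++ w ++ v)
    exact Finite.of_injective
      (fun t : {t : ParseForest g [Symbol.nonterminal B] // t.yield = w} =>
        (⟨φ t.1, by rw [huv, t.2]⟩ : {f : ParseForest g β // f.yield = u ++ w ++ v}))
      fun _ _ h => Subtype.ext (hφ (Subtype.mk.inj h))

/-- The type of nonterminals may be infinite, but a nonterminal with a tree is the left side of one
of the finitely many rules. -/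
theorem finite_good (g : ContextFreeGrammar.{u} T) : {A | Good g A}.Finite := by
  refine (g.rules.image (·.input)).finite_toSet.subset ?_
  rintro A ⟨⟨t⟩, -⟩
  obtain ⟨β, hr, -⟩ := exists_eq_node t
  exact Finset.mem_coe.2 (Finset.mem_image.2 ⟨_, hr, rfl⟩)

/-- `A` derives `B` in at least one step, the other symbols being erased. -/
def Erases (g : ContextFreeGrammar.{u} T) (B A : g.NT) : Prop :=
  ∃ φ : ParseForest g [Symbol.nonterminal B] → ParseForest g [Symbol.nonterminal A],
    ∀ t, (φ t).yield = t.yield ∧ t.size < (φ t).size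

theorem Erases.trans {A B C : g.NT} (h : Erases g A B) (h' : Erases g B C) : Erases g A C := by
  obtain ⟨φ, hφ⟩ := h
  obtain ⟨ψ, hψ⟩ := h'
  exact ⟨ψ ∘ φ, fun t => ⟨(hψ _).1.trans (hφ t).1, (hφ t).2.trans (hψ _).2⟩⟩

/-- Iterating the self-embedding keeps the yield and strictly increases the size, which gives
infinitely many trees of one string. -/
theorem Good.not_erases {A : g.NT} (hA : Good g A) : ¬ Erases g A A := by
  rintro ⟨φ, hφ⟩
  obtain ⟨t⟩ := hA.1
  have := hA.2 t.yield
  have hy (n : ℕ) : (φ^[n] t).yield = t.yield := by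
    induction n with
    | zero => rfl
    | succ n ih => rw [Function.iterate_succ_apply', (hφ _).1, ih]
  have hs : StrictMono fun n => (φ^[n] t).size :=
    strictMono_nat_of_lt_succ fun n => by
      rw [Function.iterate_succ_apply']
      exact (hφ _).2
  refine not_injective_infinite_finite
    (fun n : ℕ => (⟨φ^[n] t, hy n⟩ :
      {f : ParseForest g [Symbol.nonterminal A] // f.yield = t.yield})) fun m n h => ?_
  exact hs.injective (congrArg size (Subtype.mk.inj h))

theorem wellFounded_erases (g : ContextFreeGrammar.{u} T) :
    WellFounded fun B A : {A // Good g A} => Erases g B.1 A.1 := by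
  have : Finite {A // Good g A} := finite_good g
  have : IsTrans {A // Good g A} fun B A => Erases g B.1 A.1 := ⟨fun _ _ _ h h' => h.trans h'⟩
  have : Std.Irrefl fun B A : {A // Good g A} => Erases g B.1 A.1 := ⟨fun A => A.2.not_erases⟩
  exact Finite.wellFounded_of_trans_of_irrefl _

end ParseForest

/-! ### Matrix generating series of nondecreasing words -/

section WordSeries

variable {k : ℕ}

/-- The transition matrix of a letter for the automaton that accepts the nondecreasing words, whose
state is the last letter read. -/
def letterMatrix (l : Fin k) : Matrix (Fin k) (Fin k) (ZMod 2) :=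
  fun i j => if i ≤ j ∧ j = l then 1 else 0

/-- The transition matrix of a word. -/
def wordMatrix (w : List (Fin k)) : Matrix (Fin k) (Fin k) (ZMod 2) :=
  (w.map letterMatrix).prod

/-- The words with a given number of occurrences of every letter. -/
noncomputable def wordsWithContent (n : Fin k →₀ ℕ) : Finset (List (Fin k)) :=
  (Finsupp.toMultiset n).lists.toFinset

theorem mem_wordsWithContent {n : Fin k →₀ ℕ} {w : List (Fin k)} :
    w ∈ wordsWithContent n ↔ Multiset.toFinsupp (w : Multiset (Fin k)) = n := by
  rw [wordsWithContent, Multiset.mem_toFinset, Multiset.mem_lists_iff, Multiset.quot_mk_to_coe,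
    Multiset.toFinsupp_eq_iff, eq_comm]

/-- The matrix whose `(i, j)` entry is the sum of the words, as commutative monomials, with
coefficients `c`, over the words that lead from state `i` to state `j`. -/
noncomputable def wordSeries (c : List (Fin k) → ZMod 2) :
    Matrix (Fin k) (Fin k) (MvPowerSeries (Fin k) (ZMod 2)) :=
  fun i j n => ∑ w ∈ wordsWithContent n, c w * wordMatrix w i j

theorem coeff_wordSeries (c : List (Fin k) → ZMod 2) (i j : Fin k) (n : Fin k →₀ ℕ) :
    MvPowerSeries.coeff n (wordSeries c i j) =
      ∑ w ∈ wordsWithContent n, c w * wordMatrix w i j := rfl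

/-- A word with a marked cut is the same as a pair of words, and the contents add up. -/
theorem sum_wordsWithContent_splits (n : Fin k →₀ ℕ) (F : List (Fin k) → List (Fin k) → ZMod 2) :
    ∑ w ∈ wordsWithContent n, ∑ i ∈ Finset.range (w.length + 1), F (w.take i) (w.drop i) =
      ∑ p ∈ Finset.HasAntidiagonal.antidiagonal n, ∑ u ∈ wordsWithContent p.1, ∑ v ∈ wordsWithContent p.2,
        F u v := by
  simp_rw [← Finset.sum_product']
  rw [Finset.sum_sigma', Finset.sum_sigma']
  refine Finset.sum_bij'
    (fun x _ => ⟨(Multiset.toFinsupp (x.1.take x.2 : Multiset (Fin k)),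
      Multiset.toFinsupp (x.1.drop x.2 : Multiset (Fin k))), (x.1.take x.2, x.1.drop x.2)⟩)
    (fun y _ => ⟨y.2.1 ++ y.2.2, y.2.1.length⟩) ?_ ?_ ?_ ?_ ?_
  · rintro ⟨w, i⟩ h
    simp only [Finset.mem_sigma, mem_wordsWithContent, Finset.mem_range] at h
    simp only [Finset.mem_sigma, Finset.HasAntidiagonal.mem_antidiagonal, Finset.mem_product,
      mem_wordsWithContent, and_true]
    rw [← map_add, Multiset.coe_add, List.take_append_drop, h.1]
  · rintro ⟨⟨n₁, n₂⟩, u, v⟩ h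
    simp only [Finset.mem_sigma, Finset.HasAntidiagonal.mem_antidiagonal, Finset.mem_product,
      mem_wordsWithContent] at h
    simp only [Finset.mem_sigma, mem_wordsWithContent, Finset.mem_range, List.length_append]
    rw [← Multiset.coe_add, map_add, h.2.1, h.2.2, h.1]
    exact ⟨rfl, by omega⟩
  · rintro ⟨w, i⟩ h
    simp only [Finset.mem_sigma, Finset.mem_range] at h
    simp
    omega
  · rintro ⟨⟨n₁, n₂⟩, u, v⟩ h
    simp only [Finset.mem_sigma, Finset.HasAntidiagonal.mem_antidiagonal, Finset.mem_product,
      mem_wordsWithContent] at h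
    simp [h.2.1, h.2.2]
  · rintro ⟨w, i⟩ h
    rfl

theorem wordMatrix_append (u v : List (Fin k)) :
    wordMatrix (u ++ v) = wordMatrix u * wordMatrix v := by
  simp [wordMatrix]

/-- The reason for using matrices: recording the states makes the series multiplicative, although
concatenating two nondecreasing words need not give a nondecreasing word. -/
theorem wordSeries_mul (c d : List (Fin k) → ZMod 2) :
    wordSeries (fun w => ∑ i ∈ Finset.range (w.length + 1), c (w.take i) * d (w.drop i)) =
      wordSeries c * wordSeries d := by
  ext i j n
  have h (w : List (Fin k)) :
      (∑ s ∈ Finset.range (w.length + 1), c (w.take s) * d (w.drop s)) * wordMatrix w i j =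
        ∑ s ∈ Finset.range (w.length + 1), c (w.take s) * d (w.drop s) *
          (wordMatrix (w.take s) * wordMatrix (w.drop s)) i j := by
    rw [Finset.sum_mul]
    refine Finset.sum_congr rfl fun s _ => ?_
    rw [← wordMatrix_append, List.take_append_drop]
  simp_rw [coeff_wordSeries, h]
  rw [sum_wordsWithContent_splits n
    (fun u v => c u * d v * (wordMatrix u * wordMatrix v) i j)]
  simp_rw [Matrix.mul_apply, map_sum, MvPowerSeries.coeff_mul, coeff_wordSeries]
  symm
  rw [Finset.sum_comm]
  refine Finset.sum_congr rfl fun p _ => ?_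
  simp_rw [Finset.sum_mul_sum]
  rw [Finset.sum_comm]
  refine Finset.sum_congr rfl fun u _ => ?_
  rw [Finset.sum_comm]
  refine Finset.sum_congr rfl fun v _ => ?_
  rw [Finset.mul_sum]
  exact Finset.sum_congr rfl fun l _ => by ring

theorem wordMatrix_blockTriangular (w : List (Fin k)) : (wordMatrix w).BlockTriangular id := by
  induction w with
  | nil => simpa [wordMatrix] using Matrix.blockTriangular_one
  | cons l w ih =>
    rw [wordMatrix, List.map_cons, List.prod_cons]
    refine Matrix.BlockTriangular.mul (fun i j h => ?_) ih
    exact if_neg fun h' => absurd h (not_lt.2 h'.1)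

theorem wordSeries_blockTriangular (c : List (Fin k) → ZMod 2) :
    (wordSeries c).BlockTriangular id := by
  intro i j h
  ext n
  rw [coeff_wordSeries, map_zero]
  exact Finset.sum_eq_zero fun w _ => by rw [wordMatrix_blockTriangular w h, mul_zero]

/-- States never decrease, so a path from `i` back to `i` never leaves `i`. -/
theorem wordMatrix_apply_self {i : Fin k} {w : List (Fin k)} (h : wordMatrix w i i ≠ 0) :
    w = List.replicate w.length i := by
  induction w with
  | nil => rfl
  | cons l w ih =>
    rw [wordMatrix, List.map_cons, List.prod_cons, Matrix.mul_apply,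
      Finset.sum_eq_single i] at h
    · rw [List.length_cons, List.replicate_succ, ← ih (right_ne_zero_of_mul h)]
      have := left_ne_zero_of_mul h
      simp only [letterMatrix, ne_eq, ite_eq_right_iff, not_forall] at this
      rw [this.1.2]
    · intro m _ hm
      by_cases h' : i ≤ m
      · rw [show (w.map letterMatrix).prod m i = 0 from
          wordMatrix_blockTriangular w (lt_of_le_of_ne h' hm.symm), mul_zero]
      · simp [letterMatrix, h']
    · simp

theorem wordSeries_apply_self (c : List (Fin k) → ZMod 2) (i : Fin k) :
    ∃ f : PowerSeries (ZMod 2), wordSeries c i i = f.toMvPowerSeries i := by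
  refine ⟨PowerSeries.mk fun m => MvPowerSeries.coeff (Finsupp.single i m) (wordSeries c i i), ?_⟩
  ext n
  by_cases h : ∃ m, n = Finsupp.single i m
  · obtain ⟨m, rfl⟩ := h
    have := MvPowerSeries.coeff_embDomain_rename (Function.Embedding.punit i)
      (PowerSeries.mk fun m => MvPowerSeries.coeff (Finsupp.single i m) (wordSeries c i i))
      (Finsupp.single () m)
    rw [Finsupp.embDomain_single] at this
    erw [PowerSeries.toMvPowerSeries_apply, this]
    rw [PowerSeries.coeff_coeToMvPowerSeries, PowerSeries.coeff_mk]
  · rw [PowerSeries.toMvPowerSeries_apply]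
    have : MvPowerSeries.coeff n (MvPowerSeries.rename (fun _ => i)
        (PowerSeries.mk fun m => MvPowerSeries.coeff (Finsupp.single i m) (wordSeries c i i))) =
        0 := by
      apply MvPowerSeries.coeff_rename_eq_zero
      rintro ⟨m, rfl⟩
      refine h ⟨m (), ?_⟩
      rw [Finsupp.unique_single m, Finsupp.mapDomain_single]
      simp
    rw [this, coeff_wordSeries]
    refine Finset.sum_eq_zero fun w hw => ?_
    by_contra hne
    have hw' := wordMatrix_apply_self (right_ne_zero_of_mul hne)
    refine h ⟨w.length, ?_⟩
    rw [← mem_wordsWithContent.1 hw, hw', Multiset.coe_replicate, ← Multiset.nsmul_singleton,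
      map_nsmul, Multiset.toFinsupp_singleton]
    simp

theorem constantCoeff_wordSeries (c : List (Fin k) → ZMod 2) (i : Fin k) :
    MvPowerSeries.constantCoeff (wordSeries c i i) = c [] := by
  rw [← MvPowerSeries.coeff_zero_eq_constantCoeff_apply, coeff_wordSeries,
    Finset.sum_eq_single []]
  · simp [wordMatrix]
  · intro w hw hne
    rw [mem_wordsWithContent] at hw
    simp at hw
    exact absurd hw hne
  · intro h
    exact absurd (mem_wordsWithContent.2 (by simp)) h

theorem wordSeries_nil : wordSeries (fun w : List (Fin k) => if w = [] then 1 else 0) = 1 := by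
  ext i j n
  rw [coeff_wordSeries, Matrix.one_apply]
  simp only [ite_mul, one_mul, zero_mul]
  rw [Finset.sum_ite_eq']
  simp only [mem_wordsWithContent, wordMatrix, List.map_nil, List.prod_nil, Matrix.one_apply]
  by_cases h : i = j <;> simp [h, MvPowerSeries.coeff_one, eq_comm]

theorem wordSeries_sum {ι : Type*} (s : Finset ι) (c : ι → List (Fin k) → ZMod 2) :
    wordSeries (fun w => ∑ x ∈ s, c x w) = ∑ x ∈ s, wordSeries (c x) := by
  ext i j n
  simp_rw [Matrix.sum_apply, map_sum, coeff_wordSeries, Finset.sum_mul]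
  rw [Finset.sum_comm]

theorem wordSeries_letter {T : Type u} (a : Fin k → T) (t : T) (i j : Fin k) :
    wordSeries (fun w => if w.map a = [t] then 1 else 0) i j =
      if i ≤ j ∧ a j = t then MvPowerSeries.X j else 0 := by
  have h (w : List (Fin k)) : (if w.map a = [t] then 1 else 0) * wordMatrix w i j =
      if w = [j] then (if i ≤ j ∧ a j = t then 1 else 0) else 0 := by
    split_ifs with h1 h2 h3 h3 <;> try simp_all [wordMatrix, letterMatrix]
    obtain ⟨l, rfl, -⟩ := h1
    have : j ≠ l := fun h => h2 (by rw [h])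
    simp [letterMatrix, this]
  ext n
  simp_rw [coeff_wordSeries, h]
  rw [Finset.sum_ite_eq']
  simp only [mem_wordsWithContent, Multiset.coe_singleton, Multiset.toFinsupp_singleton]
  split_ifs with h1 h2 h2
  · rw [MvPowerSeries.coeff_X, if_pos h1.symm]
  · simp
  · rw [MvPowerSeries.coeff_X, if_neg (Ne.symm h1)]
  · simp

theorem sum_wordMatrix (i : Fin k) (w : List (Fin k)) :
    ∑ j, wordMatrix w i j = if (i :: w).IsChain (· ≤ ·) then 1 else 0 := by
  induction w generalizing i with
  | nil => simp [wordMatrix, Matrix.one_apply]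
  | cons l w ih =>
    have h (j : Fin k) : wordMatrix (l :: w) i j = if i ≤ l then wordMatrix w l j else 0 := by
      simp only [wordMatrix, List.map_cons, List.prod_cons]
      rw [Matrix.mul_apply, Finset.sum_eq_single l]
      · simp [letterMatrix]
      · intro m _ hm
        simp [letterMatrix, hm]
      · simp
    simp_rw [h, List.isChain_cons_cons, ite_and]
    split_ifs with h1 h2
    · rw [ih, if_pos h2]
    · rw [ih, if_neg h2]
    · simp

/-- The nondecreasing word with a given number of occurrences of every letter. -/
def sortedWord (n : Fin k →₀ ℕ) : List (Fin k) :=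
  (List.ofFn fun i => List.replicate (n i) i).flatten

theorem sortedWord_pairwise (n : Fin k →₀ ℕ) : (sortedWord n).Pairwise (· ≤ ·) := by
  rw [sortedWord, List.pairwise_flatten, List.pairwise_ofFn]
  constructor
  · intro l hl
    obtain ⟨i, rfl⟩ := List.mem_ofFn.1 hl
    simp [List.pairwise_replicate]
  · intro i j hij x hx y hy
    rw [List.eq_of_mem_replicate hx, List.eq_of_mem_replicate hy]
    exact hij.le

theorem toFinsupp_sortedWord (n : Fin k →₀ ℕ) :
    Multiset.toFinsupp (sortedWord n : Multiset (Fin k)) = n := by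
  ext i
  rw [Multiset.toFinsupp_apply, Multiset.coe_count, sortedWord, List.count_flatten, List.map_ofFn,
    List.sum_ofFn]
  simp [List.count_replicate]

theorem powerWord_eq_map {T : Type u} (a : Fin k → T) (n : Fin k →₀ ℕ) :
    powerWord a n = (sortedWord n).map a := by
  simp [powerWord, sortedWord, List.map_flatten, List.map_ofFn, Function.comp_def]

/-- Starting from the least state puts no condition on the first letter, so exactly the
nondecreasing words are accepted, and each content has only one. -/
theorem sum_coeff_wordSeries (c : List (Fin k) → ZMod 2) {i : Fin k} (hi : ∀ l, i ≤ l)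
    (n : Fin k →₀ ℕ) :
    MvPowerSeries.coeff n (∑ j, wordSeries c i j) = c (sortedWord n) := by
  simp_rw [map_sum, coeff_wordSeries]
  rw [Finset.sum_comm]
  have h (w : List (Fin k)) : ∑ j, c w * wordMatrix w i j =
      if w.Pairwise (· ≤ ·) then c w else 0 := by
    have hc : (i :: w).IsChain (· ≤ ·) ↔ w.Pairwise (· ≤ ·) := by
      rw [List.isChain_iff_pairwise, List.pairwise_cons]
      simp [hi]
    rw [← Finset.mul_sum, sum_wordMatrix]
    simp [hc]
  simp_rw [h]
  rw [Finset.sum_eq_single (sortedWord n), if_pos (sortedWord_pairwise n)]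
  · intro w hw hne
    refine if_neg fun hp => hne ?_
    refine List.Perm.eq_of_pairwise' hp (sortedWord_pairwise n) (Multiset.coe_eq_coe.1 ?_)
    rw [mem_wordsWithContent, ← toFinsupp_sortedWord n] at hw
    exact Multiset.toFinsupp.injective hw
  · intro h
    exact absurd (mem_wordsWithContent.2 (toFinsupp_sortedWord n)) h

end WordSeries

/-! ### Linearized systems and Cramer's rule -/

section Linearization

variable {σ R : Type*} [DecidableEq σ] [CommRing R]

/-- The coefficient of the symbol `C` in the linearization of the product of the symbols of a list:
the sum, over the occurrences of `C`, of the product of the values of `d₁` at the symbols on the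
left and of the values of `d₂` at the symbols on the right. -/
noncomputable def linearCoeff (d₁ d₂ : σ → R) : List σ → σ → R
  | [], _ => 0
  | X :: β, C => d₁ X * linearCoeff d₁ d₂ β C + if X = C then (β.map d₂).prod else 0

theorem map_linearCoeff {R' : Type*} [CommRing R'] (f : R →+* R') (d₁ d₂ : σ → R) (β : List σ)
    (C : σ) : f (linearCoeff d₁ d₂ β C) = linearCoeff (fun X => f (d₁ X)) (fun X => f (d₂ X)) β C := by
  induction β with
  | nil => simp [linearCoeff]
  | cons X β ih =>
    rw [linearCoeff, linearCoeff, map_add, map_mul, ih, apply_ite f, map_zero, map_list_prod,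
      List.map_map]
    rfl

theorem linearCoeff_mem (N : Subring R) {d₁ d₂ : σ → R} (h₁ : ∀ X, d₁ X ∈ N) (h₂ : ∀ X, d₂ X ∈ N)
    (β : List σ) (C : σ) : linearCoeff d₁ d₂ β C ∈ N := by
  induction β with
  | nil => exact N.zero_mem
  | cons X β ih =>
    rw [linearCoeff]
    refine N.add_mem (N.mul_mem (h₁ X) ih) ?_
    split_ifs
    · exact N.list_prod_mem fun y hy => by
        obtain ⟨Y, -, rfl⟩ := List.mem_map.1 hy
        exact h₂ Y
    · exact N.zero_mem

/-- The matrix of the linearization of a system of equations that expresses every symbol of `V` as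
a sum of products. -/
noncomputable def systemMatrix {V : Finset σ} (rules : V → Finset (List σ)) (d₁ d₂ : σ → R) :
    Matrix V V R :=
  fun A C => ∑ β ∈ rules A, linearCoeff d₁ d₂ β C

theorem map_det_one_sub_systemMatrix {R' : Type*} [CommRing R'] (f : R →+* R') {V : Finset σ}
    (rules : V → Finset (List σ)) (d₁ d₂ : σ → R) :
    f (1 - systemMatrix rules d₁ d₂).det =
      (1 - systemMatrix rules (fun X => f (d₁ X)) (fun X => f (d₂ X))).det := by
  rw [RingHom.map_det, map_sub, map_one]
  congr 2
  ext A C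
  simp [systemMatrix, map_linearCoeff]

theorem det_mem_subring {n : Type*} [Fintype n] [DecidableEq n] (N : Subring R) {A : Matrix n n R}
    (h : ∀ i j, A i j ∈ N) : A.det ∈ N := by
  rw [Matrix.det_apply]
  refine N.sum_mem fun τ _ => ?_
  rw [Units.smul_def]
  exact N.zsmul_mem (N.prod_mem fun i _ => h _ _) _

theorem one_sub_systemMatrix_mem (N : Subring R) {V : Finset σ} (rules : V → Finset (List σ))
    {d₁ d₂ : σ → R} (h₁ : ∀ X, d₁ X ∈ N) (h₂ : ∀ X, d₂ X ∈ N) (A C : V) :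
    (1 - systemMatrix rules d₁ d₂) A C ∈ N := by
  rw [Matrix.sub_apply, Matrix.one_apply]
  refine N.sub_mem ?_ (N.sum_mem fun β _ => linearCoeff_mem N h₁ h₂ β C)
  split_ifs
  · exact N.one_mem
  · exact N.zero_mem

/-- Multiply the relations by the adjugate; the unknowns live in a module because they will be
differentials. -/
theorem det_smul_eq_zero {n M : Type*} [Fintype n] [DecidableEq n] [AddCommGroup M] [Module R M]
    (A : Matrix n n R) (v : n → M) (h : ∀ i, ∑ j, A i j • v j = 0) (i : n) :
    A.det • v i = 0 := by
  calc A.det • v i = ∑ j, (A.adjugate * A) i j • v j := by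
        simp [Matrix.adjugate_mul, Matrix.smul_apply, Matrix.one_apply, ite_smul]
    _ = ∑ l, A.adjugate i l • ∑ j, A l j • v j := by
        simp_rw [Matrix.mul_apply, Finset.sum_smul, Finset.smul_sum, mul_smul]
        rw [Finset.sum_comm]
    _ = 0 := by simp [h]

theorem mem_of_mulVec_eq {L n : Type*} [Field L] [Fintype n] [DecidableEq n] (N : Subring L) {A : Matrix n n L}
    (hA : ∀ i j, A i j ∈ N) (hdet : A.det ≠ 0) (hinv : A.det⁻¹ ∈ N) {x c : n → L}
    (hc : ∀ i, c i ∈ N) (h : A.mulVec x = c) (i : n) : x i ∈ N := by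
  have h1 : A.det * x i = A.cramer c i := by
    rw [Matrix.cramer_eq_adjugate_mulVec, ← h, Matrix.mulVec_mulVec, Matrix.adjugate_mul,
      Matrix.smul_mulVec, Matrix.one_mulVec, Pi.smul_apply, smul_eq_mul]
  rw [← inv_mul_cancel_left₀ hdet (x i), h1, Matrix.cramer_apply]
  refine N.mul_mem hinv (det_mem_subring N fun r s => ?_)
  rw [Matrix.updateCol_apply]
  split_ifs
  · exact hc r
  · exact hA r s

/-- The Leibniz rule: for `d₁ = d₂` the coefficient `linearCoeff` is a partial derivative of the
monomial `β`. -/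
theorem Derivation.map_list_prod {K L M : Type*} [CommRing K] [CommRing L] [Algebra K L]
    [AddCommGroup M] [Module K M] [Module L M] (D : Derivation K L M) (d : σ → L) {V : Finset σ}
    (h : ∀ X ∉ V, D (d X) = 0) (β : List σ) :
    D (β.map d).prod = ∑ C : V, linearCoeff d d β C • D (d C) := by
  induction β with
  | nil => simp [linearCoeff]
  | cons X β ih =>
    simp only [List.map_cons, List.prod_cons, Derivation.leibniz, ih, linearCoeff, add_smul,
      Finset.sum_add_distrib, mul_smul, Finset.smul_sum, ite_smul, zero_smul]
    congr 1
    by_cases hX : X ∈ V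
    · rw [Finset.sum_eq_single ⟨X, hX⟩]
      · simp
      · intro C _ hC
        exact if_neg fun h => hC (Subtype.ext h.symm)
      · simp
    · rw [h X hX, smul_zero, Finset.sum_eq_zero]
      intro C _
      exact if_neg fun hC : X = C => hX (hC ▸ C.2)

end Linearization

/-! ### The Jacobian criterion for algebraicity -/

section Algebraic

/-- Applying `D` to the system gives a homogeneous linear system for the `D (y C)`, with matrix one
minus the Jacobian. -/
theorem Derivation.eq_zero_of_det_ne_zero {σ K F M : Type*} [DecidableEq σ] [CommRing K] [Field F] [Algebra K F]
    [AddCommGroup M] [Module K M] [Module F M] (D : Derivation K F M) {V : Finset σ}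
    (rules : V → Finset (List σ)) (y : σ → F) (hD : ∀ X ∉ V, D (y X) = 0)
    (hsys : ∀ A : V, y A = ∑ β ∈ rules A, (β.map y).prod)
    (hdet : (1 - systemMatrix rules y y).det ≠ 0) (A : V) : D (y A) = 0 := by
  have h (B : V) : ∑ C : V, (1 - systemMatrix rules y y) B C • D (y C) = 0 := by
    simp_rw [Matrix.sub_apply, sub_smul, Finset.sum_sub_distrib, systemMatrix, Finset.sum_smul]
    rw [Finset.sum_comm]
    simp_rw [← Derivation.map_list_prod D y hD]
    rw [← map_sum, ← hsys B]
    simp [Matrix.one_apply, ite_smul]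
  exact (smul_eq_zero.1 (det_smul_eq_zero _ (fun C : V => D (y C)) h A)).resolve_left hdet

/-- Elements with zero differential are closed under the field operations, and differentials span
the Kähler module. -/
theorem formallyUnramified_adjoin {K E : Type*} [Field K] [Field E] [Algebra K E] (s : Set E)
    (h : ∀ x (hx : x ∈ s), KaehlerDifferential.D K (IntermediateField.adjoin K s)
      ⟨x, IntermediateField.subset_adjoin K s hx⟩ = 0) :
    Algebra.FormallyUnramified K (IntermediateField.adjoin K s) := by
  have hD (z : E) (hz : z ∈ IntermediateField.adjoin K s) :
      KaehlerDifferential.D K (IntermediateField.adjoin K s) ⟨z, hz⟩ = 0 := by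
    induction hz using IntermediateField.adjoin_induction with
    | mem x hx => exact h x hx
    | algebraMap x => exact Derivation.map_algebraMap _ x
    | add x y hx hy ihx ihy =>
      have := (KaehlerDifferential.D K (IntermediateField.adjoin K s)).map_add ⟨x, hx⟩ ⟨y, hy⟩
      rw [ihx, ihy, add_zero] at this
      exact this
    | inv x hx ih =>
      have := (KaehlerDifferential.D K (IntermediateField.adjoin K s)).leibniz_inv ⟨x, hx⟩
      rw [ih, smul_zero] at this
      exact this
    | mul x y hx hy ihx ihy =>
      have := (KaehlerDifferential.D K (IntermediateField.adjoin K s)).leibniz ⟨x, hx⟩ ⟨y, hy⟩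
      rw [ihx, ihy, smul_zero, smul_zero, add_zero] at this
      exact this
  refine ⟨?_⟩
  rw [← Submodule.subsingleton_iff (IntermediateField.adjoin K s), ← subsingleton_iff_bot_eq_top,
    ← KaehlerDifferential.span_range_derivation, eq_comm, Submodule.span_eq_bot]
  rintro _ ⟨⟨z, hz⟩, rfl⟩
  exact hD z hz

/-- The components of a solution of a polynomial system are algebraic if the Jacobian determinant
does not vanish at the solution. -/
theorem isAlgebraic_of_det_ne_zero {σ K E : Type*} [DecidableEq σ] [Field K] [Field E] [Algebra K E]
    {V : Finset σ} (rules : V → Finset (List σ))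
    (f : σ → E) (hf : ∀ X ∉ V, f X ∈ (algebraMap K E).range)
    (hsys : ∀ A : V, f A = ∑ β ∈ rules A, (β.map f).prod)
    (hdet : (1 - systemMatrix rules f f).det ≠ 0) (A : V) :
    IsAlgebraic K (f A) := by
  -- Passing to a finitely generated field is needed: for essentially finite type, unramified
  -- implies separable algebraic. In positive characteristic, vanishing differentials alone would
  -- not suffice.
  let F : IntermediateField K E := IntermediateField.adjoin K ((V.image f : Finset E) : Set E)
  have hF (X : σ) : f X ∈ F := by
    by_cases hX : X ∈ V
    · exact IntermediateField.subset_adjoin _ _ (Finset.mem_coe.2 (Finset.mem_image_of_mem _ hX))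
    · obtain ⟨r, hr⟩ := hf X hX
      rw [← hr]
      exact F.algebraMap_mem _
  let y : σ → F := fun X => ⟨f X, hF X⟩
  have hD : ∀ X ∉ V, KaehlerDifferential.D K F (y X) = 0 := by
    intro X hX
    obtain ⟨r, hr⟩ := hf X hX
    have : y X = algebraMap K F r := Subtype.ext hr.symm
    rw [this, Derivation.map_algebraMap]
  have hy (B : V) : y B = ∑ β ∈ rules B, (β.map y).prod := by
    apply (algebraMap F E).injective
    rw [map_sum]
    simp_rw [map_list_prod, List.map_map]
    exact hsys B
  have hdet' : (1 - systemMatrix rules y y).det ≠ 0 := by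
    intro h0
    have := congrArg (algebraMap F E) h0
    rw [map_det_one_sub_systemMatrix, map_zero] at this
    exact hdet this
  have hunr : Algebra.FormallyUnramified K F := by
    refine formallyUnramified_adjoin _ fun x hx => ?_
    obtain ⟨X, hX, rfl⟩ := Finset.mem_image.1 (Finset.mem_coe.1 hx)
    exact Derivation.eq_zero_of_det_ne_zero _ rules y hD hy hdet' ⟨X, hX⟩
  have hess : Algebra.EssFiniteType K F :=
    IntermediateField.essFiniteType_iff.2 (IntermediateField.fg_adjoin_finset _)
  have hsep : Algebra.IsSeparable K F := (Algebra.FormallyUnramified.iff_isSeparable K F).1 hunr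
  have halg : IsAlgebraic K (y A) := Algebra.IsAlgebraic.isAlgebraic (y A)
  exact halg.algHom F.val

theorem isAlgebraic_of_det_ne_zero' {σ R S : Type*} [DecidableEq σ] [CommRing R] [IsDomain R] [CommRing S]
    [IsDomain S] [Algebra R S] [FaithfulSMul R S] {V : Finset σ} (rules : V → Finset (List σ))
    (f : σ → S) (hf : ∀ X ∉ V, f X ∈ (algebraMap R S).range)
    (hsys : ∀ A : V, f A = ∑ β ∈ rules A, (β.map f).prod)
    (hdet : (1 - systemMatrix rules f f).det ≠ 0) (A : V) :
    IsAlgebraic R (f A) := by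
  let : Algebra (FractionRing R) (FractionRing S) := FractionRing.liftAlgebra R (FractionRing S)
  have hinj := IsFractionRing.injective S (FractionRing S)
  rw [← isAlgebraic_algebraMap_iff hinj,
    IsFractionRing.isAlgebraic_iff R (FractionRing R) (FractionRing S)]
  refine isAlgebraic_of_det_ne_zero rules (fun X => algebraMap S (FractionRing S) (f X)) ?_ ?_ ?_ A
  · intro X hX
    obtain ⟨r, hr⟩ := hf X hX
    refine ⟨algebraMap R _ r, ?_⟩
    rw [← hr, ← IsScalarTower.algebraMap_apply, ← IsScalarTower.algebraMap_apply]
  · intro B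
    rw [hsys B, map_sum]
    simp_rw [map_list_prod, List.map_map]
    rfl
  · rw [← map_det_one_sub_systemMatrix]
    exact fun h => hdet ((map_eq_zero_iff _ hinj).1 h)

end Algebraic

/-! ### The ring of admissible fractions -/

section Fractions

instance MvPowerSeries.instIsDomain {σ R : Type*} [CommRing R] [IsDomain R] :
    IsDomain (MvPowerSeries σ R) :=
  NoZeroDivisors.to_isDomain _

instance PowerSeries.instFaithfulSMulPolynomial {R : Type*} [CommRing R] :
    FaithfulSMul (Polynomial R) (PowerSeries R) := by
  rw [faithfulSMul_iff_algebraMap_injective]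
  intro p q h
  rw [PowerSeries.algebraMap_apply', PowerSeries.algebraMap_apply', Algebra.algebraMap_self,
    PowerSeries.map_id] at h
  exact Polynomial.coe_injective R h

/-- The products of algebraic power series in single variables. -/
def algebraicProducts (k : ℕ) : Submonoid (MvPowerSeries (Fin k) (ZMod 2)) where
  carrier := {x | ∃ A : Fin k → PowerSeries (ZMod 2),
    (∀ j, IsAlgebraic (Polynomial (ZMod 2)) (A j)) ∧ x = ∏ j, (A j).toMvPowerSeries j}
  one_mem' := ⟨1, fun _ => isAlgebraic_one, by simp⟩
  mul_mem' := by
    rintro _ _ ⟨A, hA, rfl⟩ ⟨B, hB, rfl⟩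
    exact ⟨fun j => A j * B j, fun j => (hA j).mul (hB j), by
      simp_rw [map_mul, Finset.prod_mul_distrib]⟩

/-- The sums of products of algebraic power series in single variables. -/
noncomputable def algebraicSums (k : ℕ) : Subring (MvPowerSeries (Fin k) (ZMod 2)) where
  __ := (algebraicProducts k).subsemiringClosure
  neg_mem' := by
    intro x hx
    -- In characteristic 2 negation is the identity, so the semiring closure is already a ring.
    have : -x = x := by
      ext n
      rw [map_neg, ZMod.neg_eq_self_mod_two]
    rwa [this]

theorem mem_algebraicSums {k : ℕ} {x : MvPowerSeries (Fin k) (ZMod 2)} :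
    x ∈ algebraicSums k ↔ ∃ (n : ℕ) (A : Fin n → Fin k → PowerSeries (ZMod 2)),
      (∀ i j, IsAlgebraic (Polynomial (ZMod 2)) (A i j)) ∧
        x = ∑ i, ∏ j, (A i j).toMvPowerSeries j := by
  constructor
  · intro hx
    obtain ⟨l, hl, rfl⟩ := AddSubmonoid.exists_list_of_mem_closure
      (show x ∈ AddSubmonoid.closure (algebraicProducts k : Set _) from hx)
    choose A hA hA' using fun i : Fin l.length => hl (l.get i) (List.get_mem l i)
    refine ⟨l.length, A, hA, ?_⟩
    simp_rw [← hA']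
    rw [← List.sum_ofFn, List.ofFn_get]
  · rintro ⟨n, A, hA, rfl⟩
    exact (algebraicSums k).sum_mem fun i _ => AddSubmonoid.subset_closure ⟨A i, hA i, rfl⟩

/-- The products of nonzero polynomials in pairs of variables. -/
def pairPolynomialProducts (k : ℕ) : Submonoid (MvPowerSeries (Fin k) (ZMod 2)) where
  carrier := {x | ∃ p : Fin k → Fin k → MvPolynomial (Fin k) (ZMod 2),
    (∀ i j, i < j → p i j ≠ 0 ∧ p i j ∈ MvPolynomial.supported (ZMod 2) {i, j}) ∧
      x = ∏ i, ∏ j ∈ Finset.Ioi i, (p i j : MvPowerSeries (Fin k) (ZMod 2))}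
  one_mem' := ⟨1, fun _ _ _ => ⟨one_ne_zero, one_mem _⟩, by simp⟩
  mul_mem' := by
    rintro _ _ ⟨p, hp, rfl⟩ ⟨q, hq, rfl⟩
    refine ⟨fun i j => p i j * q i j, fun i j hij =>
      ⟨mul_ne_zero (hp i j hij).1 (hq i j hij).1, mul_mem (hp i j hij).2 (hq i j hij).2⟩, ?_⟩
    simp_rw [MvPolynomial.coe_mul, Finset.prod_mul_distrib]

theorem ne_zero_of_mem_pairPolynomialProducts {k : ℕ} {x : MvPowerSeries (Fin k) (ZMod 2)}
    (hx : x ∈ pairPolynomialProducts k) : x ≠ 0 := by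
  obtain ⟨p, hp, rfl⟩ := hx
  refine Finset.prod_ne_zero_iff.2 fun i _ => Finset.prod_ne_zero_iff.2 fun j hj => ?_
  rw [ne_eq, MvPolynomial.coe_eq_zero_iff]
  exact (hp i j (Finset.mem_Ioi.1 hj)).1

theorem coe_mem_pairPolynomialProducts {k : ℕ} {i j : Fin k} (hij : i < j)
    {p : MvPolynomial (Fin k) (ZMod 2)} (hp : p ≠ 0)
    (hp' : p ∈ MvPolynomial.supported (ZMod 2) {i, j}) :
    (p : MvPowerSeries (Fin k) (ZMod 2)) ∈ pairPolynomialProducts k := by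
  refine ⟨fun i' j' => if i' = i ∧ j' = j then p else 1, fun i' j' _ => ?_, ?_⟩
  · dsimp only
    split_ifs with h
    · rw [h.1, h.2]
      exact ⟨hp, hp'⟩
    · exact ⟨one_ne_zero, one_mem _⟩
  · rw [Finset.prod_eq_single i, Finset.prod_eq_single j]
    · simp
    · intro j' _ hj'
      simp [hj']
    · intro h
      exact absurd (Finset.mem_Ioi.2 hij) h
    · intro i' _ hi'
      simp [hi']
    · simp

theorem div_mem_seriesR {k : ℕ} {x d : MvPowerSeries (Fin k) (ZMod 2)} (hx : x ∈ algebraicSums k)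
    (hd : d ∈ pairPolynomialProducts k) :
    algebraMap _ (LaurentSeries2 k) x / algebraMap _ (LaurentSeries2 k) d ∈ seriesR k := by
  obtain ⟨n, A, hA, rfl⟩ := mem_algebraicSums.1 hx
  obtain ⟨p, hp, rfl⟩ := hd
  exact ⟨n, A, p, hA, hp, rfl⟩

theorem exists_eq_div_of_mem_seriesR {k : ℕ} {F : LaurentSeries2 k} (hF : F ∈ seriesR k) :
    ∃ x ∈ algebraicSums k, ∃ d ∈ pairPolynomialProducts k, algebraMap _ (LaurentSeries2 k) d ≠ 0 ∧
      F = algebraMap _ (LaurentSeries2 k) x / algebraMap _ (LaurentSeries2 k) d := by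
  obtain ⟨n, A, p, hA, hp, rfl⟩ := hF
  have hd : (∏ i, ∏ j ∈ Finset.Ioi i, (p i j : MvPowerSeries (Fin k) (ZMod 2))) ∈
      pairPolynomialProducts k := ⟨p, hp, rfl⟩
  exact ⟨_, mem_algebraicSums.2 ⟨n, A, hA, rfl⟩, _, hd,
    fun h => ne_zero_of_mem_pairPolynomialProducts hd
      ((map_eq_zero_iff _ (IsFractionRing.injective _ _)).1 h), rfl⟩

theorem toMvPowerSeries_mem_algebraicSums {k : ℕ} (i : Fin k) {f : PowerSeries (ZMod 2)}
    (hf : IsAlgebraic (Polynomial (ZMod 2)) f) : f.toMvPowerSeries i ∈ algebraicSums k := by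
  refine AddSubmonoid.subset_closure ⟨Pi.mulSingle i f, fun j => ?_, ?_⟩
  · obtain rfl | h := eq_or_ne j i
    · rwa [Pi.mulSingle_eq_same]
    · rw [Pi.mulSingle_eq_of_ne h]
      exact isAlgebraic_one
  · rw [Finset.prod_eq_single i]
    · rw [Pi.mulSingle_eq_same]
    · intro j _ h
      rw [Pi.mulSingle_eq_of_ne h, map_one]
    · simp

theorem coe_mem_algebraicSums {k : ℕ} (p : MvPolynomial (Fin k) (ZMod 2)) :
    (p : MvPowerSeries (Fin k) (ZMod 2)) ∈ algebraicSums k := by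
  induction p using MvPolynomial.induction_on with
  | C c =>
    rw [MvPolynomial.coe_C, ← ZMod.natCast_zmod_val c, map_natCast]
    exact natCast_mem _ _
  | add p q hp hq =>
    rw [MvPolynomial.coe_add]
    exact add_mem hp hq
  | mul_X p i hp =>
    rw [MvPolynomial.coe_mul, MvPolynomial.coe_X, ← PowerSeries.toMvPowerSeries_X]
    refine mul_mem hp (toMvPowerSeries_mem_algebraicSums i ?_)
    have := isAlgebraic_algebraMap (A := PowerSeries (ZMod 2)) (Polynomial.X : Polynomial (ZMod 2))
    simpa [PowerSeries.algebraMap_apply'] using this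

/-- The ring structure of `seriesR k`. -/
def seriesSubring (k : ℕ) : Subring (LaurentSeries2 k) where
  carrier := seriesR k
  zero_mem' := by simpa using div_mem_seriesR (zero_mem (algebraicSums k)) (one_mem _)
  one_mem' := by simpa using div_mem_seriesR (one_mem (algebraicSums k)) (one_mem _)
  add_mem' := by
    intro F G hF hG
    obtain ⟨x, hx, d, hd, hd0, rfl⟩ := exists_eq_div_of_mem_seriesR hF
    obtain ⟨y, hy, e, he, he0, rfl⟩ := exists_eq_div_of_mem_seriesR hG
    rw [div_add_div _ _ hd0 he0, ← map_mul, ← map_mul, ← map_mul, ← map_add]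
    have (p : MvPowerSeries (Fin k) (ZMod 2)) (hp : p ∈ pairPolynomialProducts k) :
        p ∈ algebraicSums k := by
      obtain ⟨p, -, rfl⟩ := hp
      exact prod_mem fun i _ => prod_mem fun j _ => coe_mem_algebraicSums _
    exact div_mem_seriesR (add_mem (mul_mem hx (this e he)) (mul_mem (this d hd) hy))
      (mul_mem hd he)
  mul_mem' := by
    intro F G hF hG
    obtain ⟨x, hx, d, hd, hd0, rfl⟩ := exists_eq_div_of_mem_seriesR hF
    obtain ⟨y, hy, e, he, he0, rfl⟩ := exists_eq_div_of_mem_seriesR hG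
    rw [div_mul_div_comm, ← map_mul, ← map_mul]
    exact div_mem_seriesR (mul_mem hx hy) (mul_mem hd he)
  neg_mem' := by
    intro F hF
    obtain ⟨x, hx, d, hd, hd0, rfl⟩ := exists_eq_div_of_mem_seriesR hF
    rw [← neg_div, ← map_neg]
    exact div_mem_seriesR (neg_mem hx) hd

theorem algebraMap_mem_seriesSubring {k : ℕ} {x : MvPowerSeries (Fin k) (ZMod 2)}
    (hx : x ∈ algebraicSums k) : algebraMap _ (LaurentSeries2 k) x ∈ seriesSubring k := by
  have := div_mem_seriesR hx (one_mem _)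
  rwa [map_one, div_one] at this

/-- The sums of products of algebraic power series in single variables that are algebraic over the
polynomials in two given variables. -/
noncomputable def pairAlgebraicSums (k : ℕ) (i j : Fin k) : Subring (MvPowerSeries (Fin k) (ZMod 2)) :=
  algebraicSums k ⊓
    (Subalgebra.algebraicClosure (MvPolynomial.supported (ZMod 2) ({i, j} : Set (Fin k)))
      (MvPowerSeries (Fin k) (ZMod 2))).toSubring

theorem algebraMap_supported_apply {k : ℕ} {s : Set (Fin k)}
    (r : MvPolynomial.supported (ZMod 2) s) :
    algebraMap (MvPolynomial.supported (ZMod 2) s) (MvPowerSeries (Fin k) (ZMod 2)) r =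
      (r : MvPolynomial (Fin k) (ZMod 2)) := by
  change algebraMap (MvPolynomial (Fin k) (ZMod 2)) (MvPowerSeries (Fin k) (ZMod 2)) r = _
  rw [MvPowerSeries.algebraMap_apply', Algebra.algebraMap_self, MvPowerSeries.map_id]
  rfl

/-- A nonzero algebraic element divides a nonzero polynomial: `s * t = r` with `t` a polynomial
expression in `s`. Hence `1 / s = t / r`, where `r` involves only the variables `i` and `j`. -/
theorem inv_mem_seriesSubring {k : ℕ} {i j : Fin k} (hij : i < j)
    {s : MvPowerSeries (Fin k) (ZMod 2)} (hs : s ∈ pairAlgebraicSums k i j) (h0 : s ≠ 0) :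
    (algebraMap _ (LaurentSeries2 k) s)⁻¹ ∈ seriesSubring k := by
  obtain ⟨hs, halg⟩ := hs
  obtain ⟨t, ht, r, hr, h⟩ :=
    IsAlgebraic.exists_nonzero_eq_adjoin_mul halg (mem_nonZeroDivisors_of_ne_zero h0)
  have ht' : t ∈ algebraicSums k := by
    clear h
    induction ht using Algebra.adjoin_induction with
    | mem x hx => rwa [Set.mem_singleton_iff.1 hx]
    | algebraMap x =>
      rw [algebraMap_supported_apply]
      exact coe_mem_algebraicSums _
    | add x y _ _ hx hy => exact add_mem hx hy
    | mul x y _ _ hx hy => exact mul_mem hx hy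
  have hr0 : (r : MvPolynomial (Fin k) (ZMod 2)) ≠ 0 := fun h => hr (Subtype.ext h)
  have := div_mem_seriesR ht' (coe_mem_pairPolynomialProducts hij hr0 r.2)
  rw [← algebraMap_supported_apply, ← h, map_mul] at this
  have ht0 : t ≠ 0 := by
    rintro rfl
    rw [mul_zero, algebraMap_supported_apply, eq_comm, MvPolynomial.coe_eq_zero_iff] at h
    exact hr0 h
  have ht0' : algebraMap _ (LaurentSeries2 k) t ≠ 0 := fun h =>
    ht0 ((map_eq_zero_iff _ (IsFractionRing.injective _ _)).1 h)
  rwa [← div_div, div_right_comm, div_self ht0', one_div] at this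

/-- An algebraic equation over one-variable polynomials stays nontrivial after renaming the variable
to the `l`-th one. -/
theorem toMvPowerSeries_mem_pairAlgebraicSums {k : ℕ} {i j l : Fin k} (hl : l = i ∨ l = j)
    {f : PowerSeries (ZMod 2)} (hf : IsAlgebraic (Polynomial (ZMod 2)) f) :
    f.toMvPowerSeries l ∈ pairAlgebraicSums k i j := by
  refine ⟨toMvPowerSeries_mem_algebraicSums l hf, ?_⟩
  let P := MvPolynomial.supported (ZMod 2) ({i, j} : Set (Fin k))
  let φ : Polynomial (ZMod 2) →+* P := Polynomial.eval₂RingHom (algebraMap (ZMod 2) P)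
    (⟨MvPolynomial.X l, MvPolynomial.X_mem_supported.2 hl⟩ : P)
  let ψ : PowerSeries (ZMod 2) →+* MvPowerSeries (Fin k) (ZMod 2) :=
    (PowerSeries.toMvPowerSeries l : _ →ₐ[ZMod 2] _).toRingHom
  have hψ : Function.Injective ψ := PowerSeries.toMvPowerSeries_injective l
  have hcomm : (algebraMap P (MvPowerSeries (Fin k) (ZMod 2))).comp φ =
      ψ.comp (algebraMap (Polynomial (ZMod 2)) (PowerSeries (ZMod 2))) := by
    apply Polynomial.ringHom_ext
    · intro c
      rw [← ZMod.natCast_zmod_val c, map_natCast, map_natCast, map_natCast]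
    · simp only [RingHom.comp_apply, φ, Polynomial.coe_eval₂RingHom, Polynomial.eval₂_X]
      rw [algebraMap_supported_apply, MvPolynomial.coe_X, PowerSeries.algebraMap_apply',
        Polynomial.coe_X, PowerSeries.map_X]
      exact (PowerSeries.toMvPowerSeries_X l).symm
  refine hf.ringHom_of_comp_eq φ ψ (Function.Injective.of_comp
    (f := algebraMap P (MvPowerSeries (Fin k) (ZMod 2))) ?_) hcomm
  rw [← RingHom.coe_comp, hcomm, RingHom.coe_comp]
  exact hψ.comp (FaithfulSMul.algebraMap_injective _ _)

end Fractions

/-! ### Solving triangular matrix systems entry by entry -/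

section Triangular

variable {σ L : Type*} {k : ℕ}

theorem blockTriangular_list_prod [CommRing L] {M : σ → Matrix (Fin k) (Fin k) L}
    (hM : ∀ X, (M X).BlockTriangular id) (β : List σ) : ((β.map M).prod).BlockTriangular id := by
  induction β with
  | nil => simpa using Matrix.blockTriangular_one
  | cons X β ih =>
    rw [List.map_cons, List.prod_cons]
    exact (hM X).mul ih

theorem list_prod_apply_self [CommRing L] {M : σ → Matrix (Fin k) (Fin k) L}
    (hM : ∀ X, (M X).BlockTriangular id) (β : List σ) (i : Fin k) :
    (β.map M).prod i i = (β.map fun X => M X i i).prod := by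
  induction β with
  | nil => simp
  | cons X β ih =>
    rw [List.map_cons, List.prod_cons, List.map_cons, List.prod_cons, Matrix.mul_apply,
      Finset.sum_eq_single i, ih]
    · intro l _ hl
      obtain h | h := lt_or_gt_of_ne hl
      · rw [hM X h, zero_mul]
      · rw [blockTriangular_list_prod hM β h, mul_zero]
    · simp

/-- A path from `p` to `q` stays between them, so it never uses an entry at `(i, j)` unless `(p, q)`
is that pair. -/
theorem list_prod_apply_mem [CommRing L] (N : Subring L) {M : σ → Matrix (Fin k) (Fin k) L}
    (hM : ∀ X, (M X).BlockTriangular id) {i j : Fin k}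
    (h : ∀ X p q, i ≤ p → q ≤ j → ¬(p = i ∧ q = j) → M X p q ∈ N) (β : List σ) {p q : Fin k}
    (hp : i ≤ p) (hq : q ≤ j) (hpq : ¬(p = i ∧ q = j)) : (β.map M).prod p q ∈ N := by
  induction β generalizing p q with
  | nil =>
    rw [List.map_nil, List.prod_nil, Matrix.one_apply]
    split_ifs
    · exact N.one_mem
    · exact N.zero_mem
  | cons X β ih =>
    rw [List.map_cons, List.prod_cons, Matrix.mul_apply]
    refine N.sum_mem fun l _ => ?_
    obtain h1 | h1 := lt_or_ge l p
    · rw [hM X h1, zero_mul]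
      exact N.zero_mem
    obtain h2 | h2 := lt_or_ge q l
    · rw [blockTriangular_list_prod hM β h2, mul_zero]
      exact N.zero_mem
    refine N.mul_mem (h X p l hp (h2.trans hq) ?_) (ih (hp.trans h1) hq ?_)
    · rintro ⟨rfl, rfl⟩
      exact hpq ⟨rfl, le_antisymm hq h2⟩
    · rintro ⟨rfl, rfl⟩
      exact hpq ⟨le_antisymm h1 hp, rfl⟩

/-- Modulo a ring that contains the other relevant entries, the entry at `(i, j)` of a product of
triangular matrices is a linear combination of the entries at `(i, j)` of the factors. -/
theorem list_prod_apply_eq_add [DecidableEq σ] [CommRing L] (N : Subring L) {M : σ → Matrix (Fin k) (Fin k) L}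
    (hM : ∀ X, (M X).BlockTriangular id) {i j : Fin k} (hij : i < j)
    (h : ∀ X p q, i ≤ p → q ≤ j → ¬(p = i ∧ q = j) → M X p q ∈ N)
    {V : Finset σ} (hV : ∀ X ∉ V, M X i j ∈ N) (β : List σ) :
    ∃ c ∈ N, (β.map M).prod i j =
      ∑ C : V, linearCoeff (fun X => M X i i) (fun X => M X j j) β C * M C i j + c := by
  induction β with
  | nil =>
    refine ⟨0, N.zero_mem, ?_⟩
    simp [linearCoeff, hij.ne]
  | cons X β ih =>
    obtain ⟨c, hc, hβ⟩ := ih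
    have hdiag : (β.map fun X => M X j j).prod = (β.map M).prod j j :=
      (list_prod_apply_self hM β j).symm
    have hj : (β.map M).prod j j ∈ N :=
      list_prod_apply_mem N hM h β hij.le le_rfl fun h => hij.ne h.1.symm
    have hi : M X i i ∈ N := h X i i le_rfl hij.le fun h => hij.ne h.2
    obtain ⟨b, hb, hX⟩ : ∃ b ∈ N, M X i j * (β.map M).prod j j =
        ∑ C : V, (if X = C then (β.map fun X => M X j j).prod else 0) * M C i j + b := by
      by_cases hXV : X ∈ V
      · refine ⟨0, N.zero_mem, ?_⟩
        rw [Finset.sum_eq_single ⟨X, hXV⟩]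
        · simp [hdiag, mul_comm]
        · intro C _ hC
          rw [if_neg fun h : X = C => hC (Subtype.ext h.symm), zero_mul]
        · simp
      · refine ⟨_, N.mul_mem (hV X hXV) hj, ?_⟩
        rw [Finset.sum_eq_zero, zero_add]
        intro C _
        rw [if_neg fun h : X = C => hXV (h ▸ C.2), zero_mul]
    -- Split by the state `l` after the first factor: `l = i` leaves the jump to the tail of the
    -- list, `l = j` makes it in `X`, and every other `l` uses only shorter entries.
    refine ⟨M X i i * c + b + ∑ l ∈ (Finset.univ.erase i).erase j, M X i l * (β.map M).prod l j,
      N.add_mem (N.add_mem (N.mul_mem hi hc) hb) (N.sum_mem fun l hl => ?_), ?_⟩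
    · simp only [Finset.mem_erase, Finset.mem_univ, and_true] at hl
      obtain h1 | h1 := lt_or_ge l i
      · rw [hM X h1, zero_mul]
        exact N.zero_mem
      obtain h2 | h2 := lt_or_ge j l
      · rw [blockTriangular_list_prod hM β h2, mul_zero]
        exact N.zero_mem
      exact N.mul_mem (h X i l le_rfl h2 fun h => hl.1 h.2)
        (list_prod_apply_mem N hM h β h1 le_rfl fun h => hl.2 h.1)
    · rw [List.map_cons, List.prod_cons, Matrix.mul_apply, ← Finset.add_sum_erase _ _
        (Finset.mem_univ i), ← Finset.add_sum_erase _ _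
        (Finset.mem_erase.2 ⟨hij.ne', Finset.mem_univ j⟩), hβ, hX]
      simp only [linearCoeff, add_mul, Finset.sum_add_distrib, mul_add, Finset.mul_sum, mul_assoc]
      ring

/-- Induction on the distance `j - i`: with all shorter entries in `N`, the entries at `(i, j)`
satisfy a linear system over `N` with determinant invertible in `N`. -/
theorem apply_mem_of_system [DecidableEq σ] [Field L] (N : Subring L) {M : σ → Matrix (Fin k) (Fin k) L}
    (hM : ∀ X, (M X).BlockTriangular id) (hdiag : ∀ X i, M X i i ∈ N)
    {V : Finset σ} (hV : ∀ X ∉ V, ∀ i j, M X i j ∈ N) (rules : V → Finset (List σ))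
    (hsys : ∀ A : V, M A = ∑ β ∈ rules A, (β.map M).prod)
    (hdet : ∀ i j, i < j →
      (1 - systemMatrix rules (fun X => M X i i) (fun X => M X j j)).det ≠ 0 ∧
      (1 - systemMatrix rules (fun X => M X i i) (fun X => M X j j)).det⁻¹ ∈ N)
    (X : σ) (i j : Fin k) : M X i j ∈ N := by
  induction hd : (j : ℕ) - i using Nat.strong_induction_on generalizing X i j with
  | _ d ih =>
    obtain h | rfl | hij := lt_trichotomy j i
    · rw [hM X h]
      exact N.zero_mem
    · exact hdiag X j
    have hin : ∀ X p q, i ≤ p → q ≤ j → ¬(p = i ∧ q = j) → M X p q ∈ N := by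
      intro X p q hp hq hpq
      refine ih ((q : ℕ) - p) ?_ X p q rfl
      have h1 : (i : ℕ) ≤ p := hp
      have h2 : (q : ℕ) ≤ j := hq
      have h3 : (i : ℕ) < j := hij
      have h4 : ¬((p : ℕ) = i ∧ (q : ℕ) = j) := fun h => hpq ⟨Fin.ext h.1, Fin.ext h.2⟩
      omega
    by_cases hX : X ∈ V
    · choose c hc hβ using list_prod_apply_eq_add N hM hij hin (fun X hX => hV X hX i j)
      refine mem_of_mulVec_eq N (one_sub_systemMatrix_mem N rules (fun X => hdiag X i)
        (fun X => hdiag X j)) (hdet i j hij).1 (hdet i j hij).2 (x := fun C : V => M C i j)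
        (c := fun A : V => ∑ β ∈ rules A, c β) (fun A => N.sum_mem fun β _ => hc β) ?_ ⟨X, hX⟩
      ext A
      rw [Matrix.sub_mulVec, Matrix.one_mulVec, Pi.sub_apply, sub_eq_iff_eq_add]
      have : M A i j = ∑ β ∈ rules A, (β.map M).prod i j := by
        rw [hsys A, Matrix.sum_apply]
      rw [this]
      simp_rw [hβ, Finset.sum_add_distrib, Matrix.mulVec, dotProduct, systemMatrix, Finset.sum_mul]
      rw [add_comm, Finset.sum_comm]
    · exact hV X hX i j

end Triangular

/-! ### The matrix system of a grammar and its determinant -/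

namespace ParseForest

variable {T : Type u} {g : ContextFreeGrammar.{u} T} {k : ℕ}

/-- Terminals and good nonterminals. -/
def GoodSymbol (g : ContextFreeGrammar.{u} T) : Symbol T g.NT → Prop
  | .terminal _ => True
  | .nonterminal A => Good g A

theorem GoodSymbol.finitelyMany {X : Symbol T g.NT} (hX : GoodSymbol g X) :
    FinitelyMany g [X] := by
  cases X with
  | terminal t => exact finitelyMany_terminal t
  | nonterminal A => exact hX.2

theorem goodSymbol_of_mem_productiveRules {A : g.NT} (hA : Good g A) {β : List (Symbol T g.NT)}
    (hβ : β ∈ productiveRules g A) {X : Symbol T g.NT} (hX : X ∈ β) : GoodSymbol g X := by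
  cases X with
  | terminal t => trivial
  | nonterminal B => exact hA.of_mem_productiveRules hβ hX

/-- The generating matrix of the yields of the forests with given roots. -/
noncomputable def forestMatrix (g : ContextFreeGrammar.{u} T) (a : Fin k → T)
    (α : List (Symbol T g.NT)) : Matrix (Fin k) (Fin k) (MvPowerSeries (Fin k) (ZMod 2)) :=
  wordSeries fun w => (count g α (w.map a) : ZMod 2)

/-- The generating matrix of the yields of the trees with a given root, if it is a good symbol. -/
noncomputable def symbolMatrix (g : ContextFreeGrammar.{u} T) (a : Fin k → T)
    (X : Symbol T g.NT) : Matrix (Fin k) (Fin k) (MvPowerSeries (Fin k) (ZMod 2)) :=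
  if GoodSymbol g X then forestMatrix g a [X] else 0

theorem forestMatrix_eq_prod (a : Fin k → T) {α : List (Symbol T g.NT)}
    (h : ∀ X ∈ α, GoodSymbol g X) : forestMatrix g a α = (α.map (symbolMatrix g a)).prod := by
  induction α with
  | nil =>
    rw [List.map_nil, List.prod_nil, ← wordSeries_nil, forestMatrix]
    simp [count_nil]
  | cons X α ih =>
    have hX := h X List.mem_cons_self
    have hα : ∀ Y ∈ α, GoodSymbol g Y := fun Y hY => h Y (List.mem_cons_of_mem _ hY)
    rw [List.map_cons, List.prod_cons, ← ih hα, symbolMatrix, if_pos hX, forestMatrix,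
      forestMatrix, forestMatrix, ← wordSeries_mul]
    congr 1
    ext w
    rw [count_cons hX.finitelyMany (finitelyMany_of_forall fun Y hY => (hα Y hY).finitelyMany)]
    simp [List.map_take, List.map_drop]

theorem symbolMatrix_nonterminal (a : Fin k → T) {A : g.NT} (hA : Good g A) :
    symbolMatrix g a (.nonterminal A) =
      ∑ β ∈ productiveRules g A, (β.map (symbolMatrix g a)).prod := by
  have h : forestMatrix g a [.nonterminal A] = ∑ β ∈ productiveRules g A, forestMatrix g a β := by
    simp_rw [forestMatrix, ← wordSeries_sum, count_nonterminal hA, Nat.cast_sum]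
  rw [symbolMatrix, if_pos (by exact hA), h]
  exact Finset.sum_congr rfl fun β hβ =>
    forestMatrix_eq_prod a fun X hX => goodSymbol_of_mem_productiveRules hA hβ hX

theorem symbolMatrix_blockTriangular (a : Fin k → T) (X : Symbol T g.NT) :
    (symbolMatrix g a X).BlockTriangular id := by
  rw [symbolMatrix]
  split_ifs
  · exact wordSeries_blockTriangular _
  · exact Matrix.blockTriangular_zero

theorem exists_symbolMatrix_apply_self (a : Fin k → T) (X : Symbol T g.NT) (i : Fin k) :
    ∃ f : PowerSeries (ZMod 2), symbolMatrix g a X i i = f.toMvPowerSeries i := by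
  rw [symbolMatrix]
  split_ifs
  · exact wordSeries_apply_self _ _
  · exact ⟨0, by simp⟩

theorem symbolMatrix_terminal (a : Fin k → T) (t : T) (i j : Fin k) :
    symbolMatrix g a (.terminal t) i j = if i ≤ j ∧ a j = t then MvPowerSeries.X j else 0 := by
  rw [symbolMatrix, if_pos (by trivial), forestMatrix, ← wordSeries_letter]
  simp_rw [count_terminal, Nat.cast_ite, Nat.cast_one, Nat.cast_zero]

/-- The parity of the number of trees with empty yield. -/
noncomputable def erasedParity (g : ContextFreeGrammar.{u} T) (X : Symbol T g.NT) : ZMod 2 :=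
  if GoodSymbol g X then (count g [X] [] : ZMod 2) else 0

theorem constantCoeff_symbolMatrix (a : Fin k → T) (X : Symbol T g.NT) (i : Fin k) :
    MvPowerSeries.constantCoeff (symbolMatrix g a X i i) = erasedParity g X := by
  rw [symbolMatrix, erasedParity]
  split_ifs
  · rw [forestMatrix, constantCoeff_wordSeries]
    rfl
  · simp

theorem exists_of_erasedParity_ne_zero {X : Symbol T g.NT} (h : erasedParity g X ≠ 0) :
    ∃ t : ParseForest g [X], t.yield = [] := by
  rw [erasedParity] at h
  split_ifs at h with hX
  · by_contra hne
    have : IsEmpty {t : ParseForest g [X] // t.yield = []} := ⟨fun t => hne ⟨t.1, t.2⟩⟩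
    exact h (by rw [count, Nat.card_of_isEmpty, Nat.cast_zero])
  · exact absurd rfl h

theorem exists_of_prod_erasedParity_ne_zero {α : List (Symbol T g.NT)}
    (h : (α.map (erasedParity g)).prod ≠ 0) : ∃ f : ParseForest g α, f.yield = [] := by
  induction α with
  | nil => exact ⟨.nil, rfl⟩
  | cons X α ih =>
    rw [List.map_cons, List.prod_cons] at h
    obtain ⟨t, ht⟩ := exists_of_erasedParity_ne_zero (left_ne_zero_of_mul h)
    obtain ⟨f, hf⟩ := ih (right_ne_zero_of_mul h)
    exact ⟨cons t f, by rw [yield_cons, ht, hf, List.nil_append]⟩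

/-- Some occurrence of `X` has only erasable siblings; filling those with trees of empty yield
embeds trees for `X` into forests for `α` without changing the yield. -/
theorem exists_of_linearCoeff_ne_zero {α : List (Symbol T g.NT)} {X : Symbol T g.NT}
    (h : linearCoeff (erasedParity g) (erasedParity g) α X ≠ 0) :
    ∃ φ : ParseForest g [X] → ParseForest g α,
      ∀ t, (φ t).yield = t.yield ∧ t.size ≤ (φ t).size := by
  induction α with
  | nil => exact absurd rfl h
  | cons Y α ih =>
    rw [linearCoeff] at h
    by_cases h1 : erasedParity g Y * linearCoeff (erasedParity g) (erasedParity g) α X = 0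
    · rw [h1, zero_add] at h
      obtain ⟨rfl, hprod⟩ := ite_ne_right_iff.1 h
      obtain ⟨f, hf⟩ := exists_of_prod_erasedParity_ne_zero hprod
      exact ⟨fun t => cons t f, fun t => ⟨by rw [yield_cons, hf, List.append_nil],
        by rw [size_cons]; omega⟩⟩
    · obtain ⟨t, ht⟩ := exists_of_erasedParity_ne_zero (left_ne_zero_of_mul h1)
      obtain ⟨φ, hφ⟩ := ih (right_ne_zero_of_mul h1)
      exact ⟨fun s => cons t (φ s), fun s => ⟨by rw [yield_cons, ht, (hφ s).1, List.nil_append],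
        by rw [size_cons]; have := (hφ s).2; omega⟩⟩

/-- The good nonterminals. -/
noncomputable def goodNonterminals (g : ContextFreeGrammar.{u} T) : Finset (Symbol T g.NT) :=
  (finite_good g).toFinset.image .nonterminal

theorem mem_goodNonterminals {X : Symbol T g.NT} :
    X ∈ goodNonterminals g ↔ ∃ A, Good g A ∧ X = .nonterminal A := by
  simp [goodNonterminals, eq_comm]

/-- The right-hand sides of the rules for a good nonterminal. -/
noncomputable def goodRules (g : ContextFreeGrammar.{u} T) :
    goodNonterminals g → Finset (List (Symbol T g.NT))
  | ⟨.nonterminal A, _⟩ => productiveRules g A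
  | ⟨.terminal _, _⟩ => ∅

theorem symbolMatrix_eq_sum (a : Fin k → T) (A : goodNonterminals g) :
    symbolMatrix g a A = ∑ β ∈ goodRules g A, (β.map (symbolMatrix g a)).prod := by
  obtain ⟨X, hX⟩ := A
  obtain ⟨A, hA, rfl⟩ := mem_goodNonterminals.1 hX
  exact symbolMatrix_nonterminal a hA

theorem symbolMatrix_of_notMem (a : Fin k → T) {X : Symbol T g.NT} (hX : X ∉ goodNonterminals g)
    (i j : Fin k) : symbolMatrix g a X i j = 0 ∨ symbolMatrix g a X i j = MvPowerSeries.X j := by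
  cases X with
  | terminal t =>
    rw [symbolMatrix_terminal]
    split_ifs
    · exact Or.inr rfl
    · exact Or.inl rfl
  | nonterminal A =>
    left
    have h : ¬ GoodSymbol g (.nonterminal A) := fun h => hX (mem_goodNonterminals.2 ⟨A, h, rfl⟩)
    rw [symbolMatrix, if_neg h, Matrix.zero_apply]

/-- A kernel vector `v` satisfies `v = N v`, and a nonzero entry of `N` from `A` to `C` means that
`A` erases down to `C`. Well-founded induction along `Erases` forces `v = 0`. -/
theorem det_one_sub_erasedParity_ne_zero (g : ContextFreeGrammar.{u} T) :
    (1 - systemMatrix (goodRules g) (erasedParity g) (erasedParity g)).det ≠ 0 := by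
  intro h
  obtain ⟨v, hv, h⟩ := Matrix.exists_mulVec_eq_zero_iff.2 h
  rw [Matrix.sub_mulVec, Matrix.one_mulVec, sub_eq_zero] at h
  refine hv ?_
  have key (A : {A // Good g A}) : v ⟨.nonterminal A.1, mem_goodNonterminals.2 ⟨A.1, A.2, rfl⟩⟩ = 0 := by
    induction A using (wellFounded_erases g).induction with
    | _ A ih =>
      rw [h, Matrix.mulVec, dotProduct]
      refine Finset.sum_eq_zero ?_
      rintro ⟨X, hX⟩ _
      obtain ⟨C, hC, rfl⟩ := mem_goodNonterminals.1 hX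
      by_contra hne
      obtain ⟨β, hβ, hlin⟩ := Finset.exists_ne_zero_of_sum_ne_zero (left_ne_zero_of_mul hne)
      obtain ⟨φ, hφ⟩ := exists_of_linearCoeff_ne_zero hlin
      have hr := (mem_productiveRules.1 hβ).1
      refine right_ne_zero_of_mul hne (ih ⟨C, hC⟩ ⟨fun t => node hr (φ t), fun t => ⟨?_, ?_⟩⟩)
      · rw [yield_node, (hφ t).1]
      · rw [size_node]
        have := (hφ t).2
        omega
  ext ⟨X, hX⟩
  obtain ⟨A, hA, rfl⟩ := mem_goodNonterminals.1 hX
  exact key ⟨A, hA⟩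

/-- The constant term of every diagonal entry comes from the empty word alone and does not depend on
the state, so one determinant over the two-element field serves all pairs `(i, j)`. -/
theorem det_one_sub_symbolMatrix_ne_zero (g : ContextFreeGrammar.{u} T) (a : Fin k → T)
    (i j : Fin k) :
    (1 - systemMatrix (goodRules g) (fun X => symbolMatrix g a X i i)
      (fun X => symbolMatrix g a X j j)).det ≠ 0 := by
  intro h
  have := congrArg MvPowerSeries.constantCoeff h
  rw [map_det_one_sub_systemMatrix, map_zero] at this
  simp_rw [constantCoeff_symbolMatrix] at this
  exact det_one_sub_erasedParity_ne_zero g this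

/-- The diagonal of a product of triangular matrices is the product of the diagonals, so the `(i,
i)` entries satisfy the grammar's system among themselves and the Jacobian criterion applies. -/
theorem exists_isAlgebraic_symbolMatrix_apply_self (a : Fin k → T) (X : Symbol T g.NT)
    (i : Fin k) : ∃ f : PowerSeries (ZMod 2), IsAlgebraic (Polynomial (ZMod 2)) f ∧
      symbolMatrix g a X i i = f.toMvPowerSeries i := by
  choose f hf using fun X => exists_symbolMatrix_apply_self (g := g) a X i
  have hinj := PowerSeries.toMvPowerSeries_injective (R := ZMod 2) i
  have hrange : ∀ X ∉ goodNonterminals g,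
      f X ∈ (algebraMap (Polynomial (ZMod 2)) (PowerSeries (ZMod 2))).range := by
    intro X hX
    obtain h | h := symbolMatrix_of_notMem a hX i i
    · rw [hf, map_eq_zero_iff _ hinj] at h
      exact ⟨0, by rw [h, map_zero]⟩
    · rw [hf, ← PowerSeries.toMvPowerSeries_X] at h
      refine ⟨Polynomial.X, ?_⟩
      rw [hinj h, PowerSeries.algebraMap_apply', Polynomial.coe_X, PowerSeries.map_X]
  refine ⟨f X, ?_, hf X⟩
  by_cases hX : X ∈ goodNonterminals g
  · refine isAlgebraic_of_det_ne_zero' (goodRules g) f hrange (fun A => hinj ?_) ?_ ⟨X, hX⟩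
    · rw [← hf, symbolMatrix_eq_sum, Matrix.sum_apply, map_sum]
      refine Finset.sum_congr rfl fun β _ => ?_
      rw [list_prod_apply_self (symbolMatrix_blockTriangular a), map_list_prod, List.map_map]
      simp_rw [hf]
      rfl
    · intro h
      have := congrArg (PowerSeries.toMvPowerSeries (R := ZMod 2) i).toRingHom h
      rw [map_det_one_sub_systemMatrix, map_zero] at this
      refine det_one_sub_symbolMatrix_ne_zero g a i i ?_
      simp_rw [hf]
      exact this
  · obtain ⟨p, hp⟩ := hrange X hX
    rw [← hp]
    exact isAlgebraic_algebraMap p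

theorem algebraMap_symbolMatrix_mem (a : Fin k → T) (X : Symbol T g.NT) (i j : Fin k) :
    algebraMap _ (LaurentSeries2 k) (symbolMatrix g a X i j) ∈ seriesSubring k := by
  let ι := algebraMap (MvPowerSeries (Fin k) (ZMod 2)) (LaurentSeries2 k)
  have hι : Function.Injective ι := IsFractionRing.injective _ _
  have hpair (X : Symbol T g.NT) {i j l : Fin k} (hl : l = i ∨ l = j) :
      symbolMatrix g a X l l ∈ pairAlgebraicSums k i j := by
    obtain ⟨f, hf, h⟩ := exists_isAlgebraic_symbolMatrix_apply_self a X l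
    rw [h]
    exact toMvPowerSeries_mem_pairAlgebraicSums hl hf
  refine apply_mem_of_system (seriesSubring k) (M := fun X => (symbolMatrix g a X).map ι)
    (fun X => ?_) (fun X i => ?_) (V := goodNonterminals g) (fun X hX i j => ?_) (goodRules g)
    (fun A => ?_) (fun i j hij => ?_) X i j
  · exact (symbolMatrix_blockTriangular a X).map ι
  · exact algebraMap_mem_seriesSubring (hpair X (j := i) (Or.inl rfl)).1
  · have hX0 : symbolMatrix g a X i j ∈ algebraicSums k := by
      obtain h | h := symbolMatrix_of_notMem a hX i j
      · rw [h]
        exact zero_mem _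
      · rw [h, ← MvPolynomial.coe_X]
        exact coe_mem_algebraicSums _
    exact algebraMap_mem_seriesSubring hX0
  · have := congrArg ι.mapMatrix (symbolMatrix_eq_sum a A)
    rw [map_sum] at this
    simp_rw [map_list_prod, List.map_map] at this
    exact this
  · have hdet := map_det_one_sub_systemMatrix ι (goodRules g) (fun X => symbolMatrix g a X i i)
      (fun X => symbolMatrix g a X j j)
    have h0 := det_one_sub_symbolMatrix_ne_zero g a i j
    simp only [Matrix.map_apply]
    rw [← hdet]
    refine ⟨fun h => h0 ((map_eq_zero_iff _ hι).1 h), inv_mem_seriesSubring hij ?_ h0⟩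
    -- The determinant is a polynomial in diagonal entries at `i` and `j` only, hence algebraic over
    -- polynomials in those two variables.
    exact det_mem_subring _ (one_sub_systemMatrix_mem _ _ (fun X => hpair X (Or.inl rfl))
      (fun X => hpair X (Or.inr rfl)))

end ParseForest

/-! ### The dual series of the described language -/

theorem coeff_dualSeries {T : Type u} {k : ℕ} (a : Fin k → T) (G : GF2Grammar T)
    (n : Fin k →₀ ℕ) : MvPowerSeries.coeff n (dualSeries a G.language) =
      (ParseForest.count G.toContextFreeGrammar [.nonterminal G.initial] (powerWord a n) :
        ZMod 2) := by
  have h : MvPowerSeries.coeff n (dualSeries a G.language) =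
      if powerWord a n ∈ G.language then 1 else 0 := rfl
  have h' : powerWord a n ∈ G.language ↔ Odd (ParseForest.count G.toContextFreeGrammar
      [.nonterminal G.initial] (powerWord a n)) := Iff.rfl
  rw [h]
  split_ifs with hodd
  · exact ((ZMod.natCast_eq_one_iff_odd).2 (h'.1 hodd)).symm
  · exact ((ZMod.natCast_eq_zero_iff_even).2 (Nat.not_odd_iff_even.1 (mt h'.2 hodd))).symm

end

theorem theorem4p2 {T : Type u} {k : ℕ} (a : Fin k → T) (ha : Function.Injective a)
    (K : Language T) (hK : K ≤ starProduct a)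
    (hG : ∃ G : GF2Grammar T, G.language = K) :
    algebraMap (MvPowerSeries (Fin k) (ZMod 2)) (LaurentSeries2 k) (dualSeries a K) ∈
      seriesR k := by
  obtain ⟨G, rfl⟩ := hG
  -- Without letters there is no starting state, but then the series is a constant.
  obtain _ | k := k
  · refine algebraMap_mem_seriesSubring (x := dualSeries a G.language) ?_
    have : dualSeries a G.language =
        (MvPolynomial.C (MvPowerSeries.coeff 0 (dualSeries a G.language)) :
          MvPolynomial (Fin 0) (ZMod 2)) := by
      ext n
      rw [Subsingleton.elim n 0]
      simp
    rw [this]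
    exact coe_mem_algebraicSums _
  -- Goodness of the initial symbol requires a tree; if there is none, the series is zero.
  by_cases hne : Nonempty (ParseForest G.toContextFreeGrammar [.nonterminal G.initial])
  · have hgood : ParseForest.GoodSymbol G.toContextFreeGrammar (.nonterminal G.initial) :=
      ⟨hne, fun w => G.finite_parseTrees w⟩
    have : dualSeries a G.language =
        ∑ j, ParseForest.symbolMatrix G.toContextFreeGrammar a (.nonterminal G.initial) 0 j := by
      ext n
      rw [ParseForest.symbolMatrix, if_pos hgood, ParseForest.forestMatrix,
        sum_coeff_wordSeries _ Fin.zero_le, coeff_dualSeries, powerWord_eq_map]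
    rw [this, map_sum]
    exact (seriesSubring (k + 1)).sum_mem fun j _ => ParseForest.algebraMap_symbolMatrix_mem a _ 0 j
  · have : dualSeries a G.language = 0 := by
      ext n
      have : IsEmpty {t : ParseForest G.toContextFreeGrammar [.nonterminal G.initial] //
        t.yield = powerWord a n} := ⟨fun t => hne ⟨t.1⟩⟩
      rw [coeff_dualSeries, ParseForest.count, Nat.card_of_isEmpty]
      simp
    rw [this, map_zero]
    exact (seriesSubring (k + 1)).zero_mem
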